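/- Let $\Delta$ be a $2$-simplex (a non-degenerate triangle) in a real vector space and let $\Gamma$ be a geometric triangulation of $\Delta$, i.e. a finite geometric simplicial complex with support $\Delta$. For a face $F$ of $\Delta$ (possibly empty) let $\Gamma_F$ be the subcomplex of faces of $\Gamma$ contained in $F$, let $h(\Gamma_F;x)=\sum_{k=0}^{m} f_{k-1}(\Gamma_F)\,x^k(1-x)^{m-k}$ with $m=\dim F+1$ (where $f_{i}$ is the number of $i$-dimensional faces and $f_{-1}=1$), and let $\ell(\Gamma;x)=\sum_{F\le\Delta}(-1)^{\dim\Delta-\dim F}h(\Gamma_F;x)$ be the local $h$-polynomial (with $\dim\varnothing=-1$). A triangulation $\Gamma'$ of $\Delta$ is a conical facet refinement of a triangulation $\Gamma''$ if every face of $\Gamma''$ is a union of faces of $\Gamma'$ and there is a facet (maximal face) $G$ of $\Gamma''$ such that $\Gamma'$ restricts to the trivial subdivision on every facet of $\Gamma''$ other than $G$, and the restriction of $\Gamma'$ to $G$ is the cone, with apex a vertex of $G$, over the restriction of $\Gamma'$ to the codimension-one face of $G$ opposite to that vertex. A triforce is a subdivision of $\Delta$ into four triangles obtained by choosing one point in the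 relative interior of each edge of $\Delta$ and joining the three chosen points pairwise. The internal edge graph $\Sigma(\Gamma)$ has as edges the edges of $\Gamma$ not contained in a proper face of $\Delta$, and as vertices the endpoints of these edges. Suppose that $\ell(\Gamma;x)=0$. Then $\Gamma$ is obtained, by a finite (possibly empty) sequence of conical facet refinements, from the trivial subdivision of $\Delta$ or from a triforce. Moreover: 1. $\Gamma$ is obtained in this way from the trivial subdivision if and only if $\Sigma(\Gamma)$ is empty or a tree; in that case, if $\Sigma(\Gamma)$ is not empty, it contains exactly one vertex of $\Delta$. 2. $\Gamma$ is obtained in this way from a triforce if and only if $\Sigma(\Gamma)$ contains a $3$-cycle; in that case $\Sigma(\Gamma)$ has Euler characteristic $0$ (as many vertices as edges) and contains no vertex of $\Delta$. -/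

import Mathlib

namespace LocalH

noncomputable section

open Polynomial Geometry

universe u

variable {E : Type u} [AddCommGroup E] [Module ℝ E]

/-- The restriction of a geometric simplicial complex to the simplex with vertex set `F`:
the subcomplex of all faces that lie in the convex hull of `F`. -/
def restrict (K : SimplicialComplex ℝ E) (F : Finset E) : SimplicialComplex ℝ E where
  faces := {s | s ∈ K.faces ∧ (s : Set E) ⊆ convexHull ℝ (F : Set E)}
  indep hs := K.indep hs.1
  isRelLowerSet_faces := by
    intro s hs
    refine ⟨K.nonempty_of_mem_faces hs.1, fun t hts ht => ⟨K.down_closed hs.1 hts ht, ?_⟩⟩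
    exact (Finset.coe_subset.2 hts).trans hs.2
  inter_subset_convexHull hs ht := K.inter_subset_convexHull hs.1 ht.1

/-- A (geometric) triangulation of the simplex with vertex set `Δ`: a finite geometric simplicial
complex whose support is the convex hull of `Δ`. -/
structure Triangulation (Δ : Finset E) where
  /-- the underlying geometric simplicial complex; its faces are the nonempty simplices -/
  complex : SimplicialComplex ℝ E
  finite_faces : complex.faces.Finite
  space_eq : complex.space = convexHull ℝ (Δ : Set E)

/-- The number `f_{k-1}` of faces with `k` vertices; the empty face is counted, so `f_{-1} = 1`. -/
def faceCount (K : SimplicialComplex ℝ E) (k : ℕ) : ℕ :=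
  if k = 0 then 1 else {s | s ∈ K.faces ∧ s.card = k}.ncard

/-- The `h`-polynomial of a triangulation `K` of a simplex with `d` vertices,
`h(K; x) = ∑ f_{k-1} x^k (1 - x)^(d-k)`.  This is the polynomial `∑ h_i x^i` with
`∑ h_i (x + 1)^(d-i) = ∑ f_{i-1} x^(d-i)`. -/
def hPoly (K : SimplicialComplex ℝ E) (d : ℕ) : ℤ[X] :=
  ∑ k ∈ Finset.range (d + 1), C (faceCount K k : ℤ) * X ^ k * (1 - X) ^ (d - k)

/-- The local `h`-polynomial `ℓ(Γ; x) = ∑_{F ≤ Δ} (-1)^(codim F) h(Γ_F; x)`, the sum being over all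
faces of `Δ`, including the empty face and `Δ` itself. -/
def localH {Δ : Finset E} (Γ : Triangulation Δ) : ℤ[X] :=
  ∑ F ∈ Δ.powerset, (-1) ^ (Δ.card - F.card) * hPoly (restrict Γ.complex F) F.card

/-- `K` is the trivial subdivision of the simplex with vertex set `F`:
its faces are the faces of that simplex. -/
def IsTrivial (K : SimplicialComplex ℝ E) (F : Finset E) : Prop :=
  K.faces = {s | s.Nonempty ∧ s ⊆ F}

/-- `Γ'` is a refinement of `Γ`: every face of `Γ` is a union of faces of `Γ'`. -/
def IsRefinement {Δ : Finset E} (Γ Γ' : Triangulation Δ) : Prop :=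
  ∀ s ∈ Γ.complex.faces, ∃ T : Set (Finset E), T ⊆ Γ'.complex.faces ∧
    convexHull ℝ (s : Set E) = ⋃ t ∈ T, convexHull ℝ (t : Set E)

/-- `Γ'` is a facet refinement of `Γ` along the facet `G`: it restricts to the trivial
subdivision on every other facet. -/
def IsFacetRefinement {Δ : Finset E} (Γ Γ' : Triangulation Δ) (G : Finset E) : Prop :=
  G ∈ Γ.complex.facets ∧ IsRefinement Γ Γ' ∧
    ∀ H ∈ Γ.complex.facets, H ≠ G → IsTrivial (restrict Γ'.complex H) H

open Classical in
/-- `K` is the cone with apex `a` over `L`. -/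
def IsCone (K L : SimplicialComplex ℝ E) (a : E) : Prop :=
  K.faces = L.faces ∪ {{a}} ∪ {t | ∃ s ∈ L.faces, t = insert a s}

open Classical in
/-- `Γ'` is a conical facet refinement of `Γ`: a facet refinement along some facet `G` such that
`Γ'_G` is the cone over `Γ'_H` for some codimension one face `H = G \ {a}` of `G`
(the apex of the cone is the vertex `a` of `G` opposite to `H`). -/
def IsConicalFacetRefinement {Δ : Finset E} (Γ Γ' : Triangulation Δ) : Prop :=
  ∃ G : Finset E, IsFacetRefinement Γ Γ' G ∧
    ∃ a ∈ G, IsCone (restrict Γ'.complex G) (restrict Γ'.complex (G.erase a)) a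

/-- `Γ'` is obtained from `Γ` by a finite (possibly empty) sequence of conical facet
refinements. -/
def IsIteratedConical {Δ : Finset E} (Γ Γ' : Triangulation Δ) : Prop :=
  Relation.ReflTransGen IsConicalFacetRefinement Γ Γ'

open Classical in
/-- `K` is a triforce subdivision of the triangle with vertex set `Δ = {a, b, c}`: the subdivision
into four triangles determined by one point in the relative interior of each edge. -/
def IsTriforce (K : SimplicialComplex ℝ E) (Δ : Finset E) : Prop :=
  ∃ a b c p q r : E, Δ = {a, b, c} ∧
    p ∈ openSegment ℝ b c ∧ q ∈ openSegment ℝ c a ∧ r ∈ openSegment ℝ a b ∧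
    K.facets = {{a, q, r}, {b, r, p}, {c, p, q}, {p, q, r}}

/-- The simplex with vertex set `s` is carried by `Δ` itself: the only face of `Δ` that contains
it is `Δ`. -/
def IsInterior (Δ s : Finset E) : Prop :=
  ∀ F ⊆ Δ, (s : Set E) ⊆ convexHull ℝ (F : Set E) → F = Δ

/-- The interior edges of a triangulation. -/
def interiorEdges {Δ : Finset E} (Γ : Triangulation Δ) : Set (Finset E) :=
  {e | e ∈ Γ.complex.faces ∧ e.card = 2 ∧ IsInterior Δ e}

/-- The vertices of the internal edge graph: the vertices incident to an interior edge. -/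
abbrev InternalVertex {Δ : Finset E} (Γ : Triangulation Δ) : Type u :=
  {v : E // ∃ e ∈ interiorEdges Γ, v ∈ e}

open Classical in
/-- The internal edge graph `Σ(Γ)`. -/
def internalEdgeGraph {Δ : Finset E} (Γ : Triangulation Δ) : SimpleGraph (InternalVertex Γ) where
  Adj v w := v ≠ w ∧ ({v.1, w.1} : Finset E) ∈ interiorEdges Γ
  symm := ⟨fun v w h => ⟨h.1.symm, by rw [Finset.pair_comm]; exact h.2⟩⟩
  loopless := ⟨fun _ h => h.1 rfl⟩

/-- `Γ` is obtained from the trivial subdivision by a sequence of conical facet refinements. -/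
def FromTrivial {Δ : Finset E} (Γ : Triangulation Δ) : Prop :=
  ∃ Γ₀ : Triangulation Δ, IsTrivial Γ₀.complex Δ ∧ IsIteratedConical Γ₀ Γ

/-- `Γ` is obtained from a triforce by a sequence of conical facet refinements. -/
def FromTriforce {Δ : Finset E} (Γ : Triangulation Δ) : Prop :=
  ∃ Γ₀ : Triangulation Δ, IsTriforce Γ₀.complex Δ ∧ IsIteratedConical Γ₀ Γ

end

end LocalH

namespace LocalH

noncomputable section

open Polynomial Geometry
open scoped Classical

universe u

variable {E : Type u} [AddCommGroup E] [Module ℝ E]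

/-! Write `n` for the number of vertices of the triangulation outside `Δ` (the new vertices). The
coefficient of `x` in the local h-polynomial is `n` minus the number of new vertices on the sides,
so its vanishing says that no vertex is interior. The coefficient of `x^2` is then the number of
interior edges minus `n`, because the edges on the sides cancel. Only these two coefficients are
used (`Labels.isBalanced`).

Every new vertex lies on an interior edge. If a new vertex `v` lies on only one, say `{v, a}`, its
star is a pair of triangles `a v u` and `a v w` with `u, v, w` on a common side of `Δ`. Merging them
into `a u w` removes one new vertex and one interior edge, and the original triangulation is a
conical facet refinement of the result with apex `a`. This is the induction step. If there is no
such vertex, double counting makes the graph of interior edges 2-regular with vertex set the new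
vertices (`Labels.exists_unique_or_isRigid`). When `n = 0` the triangulation is trivial. When `n >
0` each corner of `Δ` is cut off by an edge; the triangle beyond the edge at one corner must have
its third vertex on the opposite side, and 2-regularity then closes the figure up to a triforce
(`Labels.isTriforce_of_isRigid`).

Undoing a merge hangs `v` as a leaf on `a`, which already belongs to the graph unless the graph was
empty and `a` is a vertex of `Δ`. Hence trees stay trees with exactly one vertex of `Δ`, and the
triforce case keeps Euler characteristic `0` and avoids `Δ`.

For the equivalences the two families must be disjoint. An interior edge lies in two triangles and a
conical facet refinement subdivides only one facet, so interior edges survive. A triforce therefore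
passes on its 3-cycle, while the first nontrivial refinement of the trivial subdivision creates an
interior edge at a vertex of `Δ`, which is never lost. -/

/-! ### Faces meeting at a point of a geometric complex -/

/-- The weights of an affinely independent finite set are unique. -/
theorem weights_unique {s : Finset E} (hs : AffineIndependent ℝ ((↑) : s → E)) {c d : E → ℝ}
    (hsum : ∑ i ∈ s, c i = ∑ i ∈ s, d i) (heq : ∑ i ∈ s, c i • i = ∑ i ∈ s, d i • i) :
    ∀ i ∈ s, c i = d i := by
  intro i hi
  have h := affineIndependent_iff.1 hs Finset.univ (fun i => c i - d i)
    (by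
      rw [Finset.sum_coe_sort s (fun i => c i - d i), Finset.sum_sub_distrib, hsum, sub_self])
    (by
      rw [Finset.sum_coe_sort s (fun i => (c i - d i) • i)]
      simp only [sub_smul, Finset.sum_sub_distrib]
      rw [heq, sub_self])
    ⟨i, hi⟩ (Finset.mem_univ _)
  exact sub_eq_zero.1 h

/-- A face meeting the relative interior of another face contains it. -/
theorem face_subset_of_pos {K : SimplicialComplex ℝ E} {τ σ : Finset E} (hτ : τ ∈ K.faces)
    (hσ : σ ∈ K.faces) {c : E → ℝ} (hpos : ∀ i ∈ τ, 0 < c i) (hsum : ∑ i ∈ τ, c i = 1)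
    (hmem : ∑ i ∈ τ, c i • i ∈ convexHull ℝ (σ : Set E)) : τ ⊆ σ := by
  have h1 : ∑ i ∈ τ, c i • i ∈ convexHull ℝ (τ : Set E) :=
    Finset.mem_convexHull'.2 ⟨c, fun i hi => (hpos i hi).le, hsum, rfl⟩
  have h2 := K.inter_subset_convexHull hτ hσ ⟨h1, hmem⟩
  rw [← Finset.coe_inter, Finset.mem_convexHull'] at h2
  obtain ⟨d, -, hdsum, hd⟩ := h2
  -- The point also has weights supported on `τ ∩ σ`. Uniqueness makes `c` vanish off `σ`, which
  -- positivity forbids.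
  have key := weights_unique (K.indep hτ) (c := c) (d := fun i => if i ∈ σ then d i else 0)
    (by rw [hsum, ← Finset.sum_filter, Finset.filter_mem_eq_inter, hdsum])
    (by simp only [ite_smul, zero_smul]
        rw [← Finset.sum_filter, Finset.filter_mem_eq_inter, hd])
  intro i hi
  by_contra hiσ
  have := key i hi
  simp only [hiσ, if_false] at this
  exact (hpos i hi).ne' this

theorem vertex_mem_of_mem_hull {K : SimplicialComplex ℝ E} {v : E} {σ : Finset E}
    (hv : {v} ∈ K.faces) (hσ : σ ∈ K.faces) (h : v ∈ convexHull ℝ (σ : Set E)) : v ∈ σ :=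
  (SimplicialComplex.vertex_mem_convexHull_iff hv hσ).1 h

theorem vertex_of_mem {K : SimplicialComplex ℝ E} {v : E} {σ : Finset E}
    (hσ : σ ∈ K.faces) (h : v ∈ σ) : {v} ∈ K.faces :=
  K.down_closed hσ (by simpa using h) (by simp)

theorem edge_of_mem {K : SimplicialComplex ℝ E} {v w : E} {σ : Finset E}
    (hσ : σ ∈ K.faces) (hv : v ∈ σ) (hw : w ∈ σ) : {v, w} ∈ K.faces :=
  K.down_closed hσ (by intro x; simp; rintro (rfl | rfl) <;> assumption) (by simp)

theorem triangle_of_mem {K : SimplicialComplex ℝ E} {v w a : E} {σ : Finset E}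
    (hσ : σ ∈ K.faces) (hv : v ∈ σ) (hw : w ∈ σ) (ha : a ∈ σ) : {v, w, a} ∈ K.faces :=
  K.down_closed hσ (by intro x; simp; rintro (rfl | rfl | rfl) <;> assumption) (by simp)

/-- A point strictly between `v` and `w` has positive weights on both. The degenerate case `v = w`
is kept, so that no distinctness has to be carried along. -/
theorem edge_subset_of_lineMap_mem {K : SimplicialComplex ℝ E} {v w : E} {σ : Finset E}
    (hvw : {v, w} ∈ K.faces) (hσ : σ ∈ K.faces) {t : ℝ} (h0 : 0 < t) (h1 : t < 1)
    (h : AffineMap.lineMap v w t ∈ convexHull ℝ (σ : Set E)) : v ∈ σ ∧ w ∈ σ := by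
  by_cases hne : v = w
  · subst hne
    simp only [AffineMap.lineMap_same, AffineMap.const_apply] at h
    have := vertex_mem_of_mem_hull (by simpa using hvw) hσ h
    exact ⟨this, this⟩
  have := face_subset_of_pos hvw hσ (c := fun i => if i = w then t else 1 - t)
    (by intro i _; split_ifs <;> linarith)
    (by rw [Finset.sum_pair hne]; simp [hne])
    (by rw [Finset.sum_pair hne]; simpa [hne, AffineMap.lineMap_apply_module] using h)
  exact ⟨this (by simp), this (by simp)⟩

/-- Two edges emanating from a vertex in the same direction coincide. -/
theorem eq_of_edges_same_ray {K : SimplicialComplex ℝ E} {v x y : E}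
    (hx : {v, x} ∈ K.faces) (hy : {v, y} ∈ K.faces) (hvx : v ≠ x) {s : ℝ} (hs : 0 < s)
    (h : y = AffineMap.lineMap v x s) : x = y := by
  -- Whichever of `x`, `y` is nearer to `v` lies on the edge to the other one, hence is a vertex of
  -- that edge.
  rcases le_total s 1 with h1 | h1
  · have hmem : y ∈ convexHull ℝ (({v, x} : Finset E) : Set E) := by
      rw [Finset.coe_pair, convexHull_pair, segment_eq_image_lineMap]
      exact ⟨s, ⟨hs.le, h1⟩, h.symm⟩
    have := vertex_mem_of_mem_hull (vertex_of_mem hy (by simp)) hx hmem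
    simp only [Finset.mem_insert, Finset.mem_singleton] at this
    rcases this with h2 | h2
    · exfalso
      rw [h2] at h
      have := (AffineMap.lineMap_eq_left_iff (k := ℝ)).1 h.symm
      rcases this with h3 | h3
      · exact hvx h3
      · exact hs.ne' h3
    · exact h2.symm
  · have hmem : x ∈ convexHull ℝ (({v, y} : Finset E) : Set E) := by
      rw [Finset.coe_pair, convexHull_pair, segment_eq_image_lineMap]
      refine ⟨s⁻¹, ⟨by positivity, inv_le_one_of_one_le₀ h1⟩, ?_⟩
      rw [h, AffineMap.lineMap_lineMap_right, inv_mul_cancel₀ hs.ne', AffineMap.lineMap_apply_one]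
    have := vertex_mem_of_mem_hull (vertex_of_mem hx (by simp)) hy hmem
    simp only [Finset.mem_insert, Finset.mem_singleton] at this
    rcases this with h2 | h2
    · exact absurd h2.symm hvx
    · exact h2

theorem map_lineMap_real (φ : E →ᵃ[ℝ] ℝ) (x y : E) (t : ℝ) :
    φ (AffineMap.lineMap x y t) = φ x + t * (φ y - φ x) := by
  rw [AffineMap.apply_lineMap, AffineMap.lineMap_apply_module, smul_eq_mul, smul_eq_mul]
  ring

/-! ### Barycentric coordinates -/

/-- `l` is a family of affine functions extending the barycentric coordinates of the simplex with
vertex set `Δ`. -/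
def IsCoord (Δ : Finset E) (l : E → E →ᵃ[ℝ] ℝ) : Prop :=
  ∀ a ∈ Δ, ∀ b ∈ Δ, l a b = if a = b then 1 else 0

/-- Extend `Δ` to an affine basis of the whole space and take its coordinate functions. The value
`0` for labels outside the basis is never seen. -/
theorem exists_isCoord {Δ : Finset E} (hΔ : AffineIndependent ℝ ((↑) : Δ → E)) :
    ∃ l, IsCoord Δ l := by
  obtain ⟨t, hst, hind, hspan⟩ := exists_subset_affineIndependent_affineSpan_eq_top
    (k := ℝ) (s := (Δ : Set E)) hΔ
  let b : AffineBasis t ℝ E := ⟨_, hind, by simpa using hspan⟩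
  refine ⟨fun a => if h : a ∈ t then b.coord ⟨a, h⟩ else 0, fun a ha c hc => ?_⟩
  have ha' := hst ha
  have hc' := hst hc
  simp only [ha', dif_pos]
  have := b.coord_apply ⟨a, ha'⟩ ⟨c, hc'⟩
  refine this.trans ?_
  by_cases hac : a = c <;> simp [hac]

section Coord

variable {Δ : Finset E} {l : E → E →ᵃ[ℝ] ℝ} (hl : IsCoord Δ l)
include hl

theorem IsCoord.apply_sum {c : E → ℝ} (hc : ∑ i ∈ Δ, c i = 1) {i : E} (hi : i ∈ Δ) :
    l i (∑ j ∈ Δ, c j • j) = c i := by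
  have h := Finset.map_affineCombination Δ (id : E → E) c hc (l i)
  rw [Finset.affineCombination_eq_linear_combination _ _ _ hc,
    Finset.affineCombination_eq_linear_combination _ _ _ hc] at h
  simp only [id, Function.comp] at h
  rw [h]
  rw [Finset.sum_congr rfl (fun j hj => by rw [hl i hi j hj])]
  simp [hi]

theorem IsCoord.nonneg {x : E} (hx : x ∈ convexHull ℝ (Δ : Set E)) {i : E} (hi : i ∈ Δ) :
    0 ≤ l i x := by
  obtain ⟨w, hw, hs, rfl⟩ := Finset.mem_convexHull'.1 hx
  rw [hl.apply_sum hs hi]; exact hw i hi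

theorem IsCoord.sum_eq_one {x : E} (hx : x ∈ convexHull ℝ (Δ : Set E)) :
    ∑ i ∈ Δ, l i x = 1 := by
  obtain ⟨w, hw, hs, rfl⟩ := Finset.mem_convexHull'.1 hx
  rw [Finset.sum_congr rfl (fun i hi => hl.apply_sum hs hi), hs]

theorem IsCoord.sum_smul {x : E} (hx : x ∈ convexHull ℝ (Δ : Set E)) :
    ∑ i ∈ Δ, l i x • i = x := by
  obtain ⟨w, hw, hs, rfl⟩ := Finset.mem_convexHull'.1 hx
  rw [Finset.sum_congr rfl (fun i hi => by rw [hl.apply_sum hs hi])]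

/-- The parameter `t` is unrestricted: coordinates sum to one along the whole line, so only their
signs matter. This permits moving past the endpoints. -/
theorem IsCoord.lineMap_mem {x y : E} (hx : x ∈ convexHull ℝ (Δ : Set E))
    (hy : y ∈ convexHull ℝ (Δ : Set E)) {t : ℝ}
    (h : ∀ i ∈ Δ, 0 ≤ l i (AffineMap.lineMap x y t)) :
    AffineMap.lineMap x y t ∈ convexHull ℝ (Δ : Set E) := by
  refine Finset.mem_convexHull'.2 ⟨fun i => l i (AffineMap.lineMap x y t), h, ?_, ?_⟩
  · simp only [map_lineMap_real, Finset.sum_add_distrib, ← Finset.mul_sum,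
      Finset.sum_sub_distrib, hl.sum_eq_one hx, hl.sum_eq_one hy]
    ring
  · conv_rhs => rw [← hl.sum_smul hx, ← hl.sum_smul hy, AffineMap.lineMap_apply_module,
      Finset.smul_sum, Finset.smul_sum, ← Finset.sum_add_distrib]
    refine Finset.sum_congr rfl fun i _ => ?_
    beta_reduce
    rw [map_lineMap_real]
    module

theorem IsCoord.mem_face_iff {F : Finset E} (hF : F ⊆ Δ) {x : E}
    (hx : x ∈ convexHull ℝ (Δ : Set E)) :
    x ∈ convexHull ℝ (F : Set E) ↔ ∀ i ∈ Δ, i ∉ F → l i x = 0 := by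
  constructor
  · intro h i hi hiF
    obtain ⟨w, hw, hs, rfl⟩ := Finset.mem_convexHull'.1 h
    have e1 : ∑ j ∈ F, w j • j = ∑ j ∈ Δ, (if j ∈ F then w j else 0) • j := by
      simp only [ite_smul, zero_smul]
      rw [← Finset.sum_filter, Finset.filter_mem_eq_inter, Finset.inter_eq_right.2 hF]
    rw [e1, hl.apply_sum _ hi, if_neg hiF]
    rw [← Finset.sum_filter, Finset.filter_mem_eq_inter, Finset.inter_eq_right.2 hF, hs]
  · intro h
    refine Finset.mem_convexHull'.2 ⟨fun i => l i x, fun i hi => hl.nonneg hx (hF hi), ?_, ?_⟩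
    · rw [Finset.sum_subset hF (fun i hi hiF => h i hi hiF), hl.sum_eq_one hx]
    · rw [Finset.sum_subset hF (fun i hi hiF => by simp [h i hi hiF]), hl.sum_smul hx]

theorem IsCoord.isInterior_iff {s : Finset E} (hs : (s : Set E) ⊆ convexHull ℝ (Δ : Set E)) :
    IsInterior Δ s ↔ ∀ i ∈ Δ, ∃ v ∈ s, 0 < l i v := by
  constructor
  · intro h i hi
    by_contra! hcon
    -- If coordinate `i` vanished on all of `s`, the face opposite to `i` would carry `s`.
    have := h (Δ.erase i) (Finset.erase_subset _ _) (fun v hv => by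
      rw [hl.mem_face_iff (Finset.erase_subset _ _) (hs hv)]
      intro j hj hjF
      have : j = i := by simpa [hj] using hjF
      subst this
      exact le_antisymm (hcon v hv) (hl.nonneg (hs hv) hj))
    rw [← this] at hi
    simp at hi
  · intro h F hF hsF
    refine Finset.Subset.antisymm hF fun i hi => ?_
    by_contra hiF
    obtain ⟨v, hv, hpos⟩ := h i hi
    exact hpos.ne' ((hl.mem_face_iff hF (hs hv)).1 (hsF hv) i hi hiF)

/-- If all points of a segment close to its start lie in a simplex, then so does the start. -/
theorem IsCoord.left_mem_of_lineMap_mem {x y : E} {δ : ℝ} (hδ : 0 < δ)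
    (h : ∀ t : ℝ, 0 < t → t ≤ δ → AffineMap.lineMap x y t ∈ convexHull ℝ (Δ : Set E)) :
    x ∈ convexHull ℝ (Δ : Set E) := by
  have h1 := h δ hδ le_rfl
  have h2 := h (δ / 2) (by linarith) (by linarith)
  -- The start is reached by extrapolating from the points at `δ` and `δ / 2`, so only nonnegativity
  -- of its coordinates is at stake.
  have hx : x = AffineMap.lineMap (AffineMap.lineMap x y δ) (AffineMap.lineMap x y (δ / 2))
      (2 : ℝ) := by
    simp only [AffineMap.lineMap_apply_module]
    module
  rw [hx]
  refine hl.lineMap_mem h1 h2 fun i hi => ?_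
  rw [← hx]
  by_contra! hneg
  have hb : 0 < l i (AffineMap.lineMap x y δ) - l i x := by
    have := hl.nonneg h1 hi; linarith
  have e : ∀ t, l i (AffineMap.lineMap x y t) = l i x + t * (l i y - l i x) := by
    exact fun t => map_lineMap_real _ _ _ _
  have hb' : 0 < l i y - l i x := by
    rw [e] at hb
    have : 0 < δ * (l i y - l i x) := by linarith
    exact pos_of_mul_pos_right this hδ.le
  set m := l i y - l i x
  -- If the coordinate were negative at `x` with slope `m > 0`, then up to parameter `-(l i x) / (2
  -- * m)` it would stay below half its initial value, hence negative.
  have := hl.nonneg (h (min δ (-(l i x) / (2 * m))) (lt_min hδ (by apply div_pos <;> linarith))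
    (min_le_left _ _)) hi
  rw [e] at this
  have h3 : min δ (-(l i x) / (2 * m)) * m ≤ -(l i x) / (2 * m) * m :=
    mul_le_mul_of_nonneg_right (min_le_right _ _) hb'.le
  have h4 : -(l i x) / (2 * m) * m = - l i x / 2 := by field_simp
  linarith

end Coord

/-! ### Germs of segments -/

section Germ

variable {Δ : Finset E} (Γ : Triangulation Δ)

theorem Triangulation.hull_subset {s : Finset E} (hs : s ∈ Γ.complex.faces) :
    convexHull ℝ (s : Set E) ⊆ convexHull ℝ (Δ : Set E) := by
  rw [← Γ.space_eq]; exact SimplicialComplex.convexHull_subset_space hs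

theorem Triangulation.face_subset {s : Finset E} (hs : s ∈ Γ.complex.faces) :
    (s : Set E) ⊆ convexHull ℝ (Δ : Set E) :=
  (subset_convexHull ℝ _).trans (Γ.hull_subset hs)

theorem Triangulation.mem_of_mem_face {s : Finset E} (hs : s ∈ Γ.complex.faces) {x : E}
    (hx : x ∈ s) : x ∈ convexHull ℝ (Δ : Set E) := Γ.face_subset hs hx

theorem Triangulation.exists_face {x : E} (hx : x ∈ convexHull ℝ (Δ : Set E)) :
    ∃ σ ∈ Γ.complex.faces, x ∈ convexHull ℝ (σ : Set E) := by
  rw [← Γ.space_eq] at hx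
  exact SimplicialComplex.mem_space_iff.1 hx

/-- Every segment in a triangulated simplex starts inside a single face. -/
theorem Triangulation.exists_face_germ {x y : E} (hx : x ∈ convexHull ℝ (Δ : Set E))
    (hy : y ∈ convexHull ℝ (Δ : Set E)) :
    ∃ σ ∈ Γ.complex.faces, x ∈ convexHull ℝ (σ : Set E) ∧ ∃ δ : ℝ, 0 < δ ∧ δ ≤ 1 ∧
      AffineMap.lineMap x y δ ∈ convexHull ℝ (σ : Set E) := by
  have hmem : ∀ n : ℕ, AffineMap.lineMap x y (1 / ((n : ℝ) + 1)) ∈ convexHull ℝ (Δ : Set E) := by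
    intro n
    refine (convex_convexHull ℝ _).segment_subset hx hy ?_
    rw [segment_eq_image_lineMap]
    exact ⟨_, ⟨by positivity, by rw [div_le_one (by positivity)]; linarith [n.cast_nonneg (α := ℝ)]⟩, rfl⟩
  choose f hf hf' using fun n => Γ.exists_face (hmem n)
  have : Finite Γ.complex.faces := Γ.finite_faces
  -- Pigeonhole: one of the finitely many faces contains infinitely many of the points at parameters
  -- `1 / (n + 1)`. By convexity it then contains all sufficiently small positive parameters.
  obtain ⟨⟨σ, hσ⟩, hinf⟩ := Finite.exists_infinite_fiber (fun n => (⟨f n, hf n⟩ : Γ.complex.faces))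
  have hinf' : Set.Infinite {n | f n = σ} := by
    rw [Set.infinite_coe_iff] at hinf
    refine hinf.mono fun n hn => ?_
    simpa using hn
  have key : ∀ n, f n = σ → AffineMap.lineMap x y (1 / ((n : ℝ) + 1)) ∈ convexHull ℝ (σ : Set E) :=
    fun n hn => hn ▸ hf' n
  obtain ⟨n₀, hn₀⟩ := hinf'.nonempty
  refine ⟨σ, hσ, ?_, 1 / ((n₀ : ℝ) + 1), by positivity, by
    rw [div_le_one (by positivity)]; linarith [n₀.cast_nonneg (α := ℝ)], key _ hn₀⟩
  obtain ⟨m, hm⟩ := exists_isCoord (Γ.complex.indep hσ)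
  refine hm.left_mem_of_lineMap_mem (δ := 1 / ((n₀ : ℝ) + 1)) (y := y) (by positivity) ?_
  intro t ht htδ
  obtain ⟨N, hN⟩ := exists_nat_one_div_lt ht
  obtain ⟨n, hn, hNn⟩ := hinf'.exists_gt N
  have h3 : 1 / ((n : ℝ) + 1) ≤ t := by
    refine le_trans ?_ hN.le
    apply one_div_le_one_div_of_le (by positivity)
    have : (N : ℝ) < n := by exact_mod_cast hNn
    linarith
  have hcv : Convex ℝ ((AffineMap.lineMap x y : ℝ →ᵃ[ℝ] E) ⁻¹' convexHull ℝ (σ : Set E)) :=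
    (convex_convexHull ℝ _).affine_preimage _
  exact hcv.ordConnected.out (key _ hn) (key _ hn₀) ⟨h3, htδ⟩

/-- Otherwise the half-space `φ ≤ 0` would contain the hull. Used to extract a suitable vertex from
a face containing a germ. -/
theorem exists_pos_of_mem_hull {σ : Finset E} {x : E} (hx : x ∈ convexHull ℝ (σ : Set E))
    (φ : E →ᵃ[ℝ] ℝ) (h : 0 < φ x) : ∃ a ∈ σ, 0 < φ a := by
  by_contra! hcon
  have : convexHull ℝ (σ : Set E) ⊆ φ ⁻¹' Set.Iic 0 :=
    convexHull_min (fun a ha => hcon a ha) ((convex_Iic 0).affine_preimage φ)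
  exact absurd (this hx) (not_le.2 h)

end Germ

/-! ### Coordinates on a labelled triangle -/

/-- A labelling of the vertices of a triangle `Δ` with barycentric coordinates `l`. -/
structure Labels (Δ : Finset E) (l : E → E →ᵃ[ℝ] ℝ) (A B C : E) : Prop where
  coord : IsCoord Δ l
  eq : Δ = {A, B, C}
  ab : A ≠ B
  bc : B ≠ C
  ca : C ≠ A

/-- The affine function with prescribed values at the vertices of a triangle. -/
def combo (l : E → E →ᵃ[ℝ] ℝ) (A B C : E) (a b c : ℝ) : E →ᵃ[ℝ] ℝ :=
  a • l A + b • l B + c • l C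

theorem combo_apply (l : E → E →ᵃ[ℝ] ℝ) (A B C : E) (a b c : ℝ) (x : E) :
    combo l A B C a b c x = a * l A x + b * l B x + c * l C x := by
  simp [combo]

namespace Labels

variable {Δ : Finset E} {l : E → E →ᵃ[ℝ] ℝ} {A B C : E} (h : Labels Δ l A B C)
include h

/-- `rot` and `swap` generate all relabellings, so statements are proved for one vertex or side and
transported to the others. -/
theorem rot : Labels Δ l B C A :=
  ⟨h.coord, by rw [h.eq]; ext x; simp; tauto, h.bc, h.ca, h.ab⟩

theorem swap : Labels Δ l A C B :=
  ⟨h.coord, by rw [h.eq]; ext x; simp; tauto, h.ca.symm, h.bc.symm, h.ab.symm⟩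

theorem memA : A ∈ Δ := by simp [h.eq]
theorem memB : B ∈ Δ := by simp [h.eq]
theorem memC : C ∈ Δ := by simp [h.eq]

theorem hullA : A ∈ convexHull ℝ (Δ : Set E) := subset_convexHull ℝ _ h.memA

theorem lAA : l A A = 1 := by rw [h.coord _ h.memA _ h.memA, if_pos rfl]
theorem lAB : l A B = 0 := by rw [h.coord _ h.memA _ h.memB, if_neg h.ab]
theorem lAC : l A C = 0 := by rw [h.coord _ h.memA _ h.memC, if_neg h.ca.symm]
theorem lBA : l B A = 0 := h.rot.lAC
theorem lBB : l B B = 1 := h.rot.lAA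
theorem lBC : l B C = 0 := h.rot.lAB
theorem lCA : l C A = 0 := h.rot.rot.lAB
theorem lCB : l C B = 0 := h.rot.rot.lAC
theorem lCC : l C C = 1 := h.rot.rot.lAA

theorem forall_iff {p : E → Prop} : (∀ i ∈ Δ, p i) ↔ p A ∧ p B ∧ p C := by
  simp [h.eq]

theorem sum {x : E} (hx : x ∈ convexHull ℝ (Δ : Set E)) : l A x + l B x + l C x = 1 := by
  have := h.coord.sum_eq_one hx
  rw [h.eq, Finset.sum_insert (by simp [h.ab, h.ca.symm]), Finset.sum_pair h.bc] at this
  linarith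

theorem repr {x : E} (hx : x ∈ convexHull ℝ (Δ : Set E)) :
    l A x • A + l B x • B + l C x • C = x := by
  have := h.coord.sum_smul hx
  rw [h.eq, Finset.sum_insert (by simp [h.ab, h.ca.symm]), Finset.sum_pair h.bc] at this
  rw [add_assoc]; exact this

theorem nonnegA {x : E} (hx : x ∈ convexHull ℝ (Δ : Set E)) : 0 ≤ l A x :=
  h.coord.nonneg hx h.memA

theorem ext {x y : E} (hx : x ∈ convexHull ℝ (Δ : Set E)) (hy : y ∈ convexHull ℝ (Δ : Set E))
    (hA : l A x = l A y) (hB : l B x = l B y) : x = y := by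
  have hC : l C x = l C y := by linarith [h.sum hx, h.sum hy]
  rw [← h.repr hx, ← h.repr hy, hA, hB, hC]

theorem eq_lineMap {x y z : E} (hx : x ∈ convexHull ℝ (Δ : Set E))
    (hy : y ∈ convexHull ℝ (Δ : Set E)) (hz : z ∈ convexHull ℝ (Δ : Set E)) {t : ℝ}
    (hA : l A z = l A x + t * (l A y - l A x)) (hB : l B z = l B x + t * (l B y - l B x)) :
    z = AffineMap.lineMap x y t := by
  have hC : l C z = l C x + t * (l C y - l C x) := by
    linear_combination h.sum hz - (1 - t) * h.sum hx - t * h.sum hy - hA - hB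
  rw [← h.repr hx, ← h.repr hy, ← h.repr hz, hA, hB, hC, AffineMap.lineMap_apply_module]
  module

theorem eq_A {x : E} (hx : x ∈ convexHull ℝ (Δ : Set E)) (hB : l B x = 0) (hC : l C x = 0) :
    x = A := by
  refine h.rot.ext hx h.hullA ?_ ?_
  · rw [hB, h.lBA]
  · rw [hC, h.lCA]

theorem side_pos {x : E} (hx : x ∈ convexHull ℝ (Δ : Set E)) (hxΔ : x ∉ Δ) (hA : l A x = 0) :
    0 < l B x ∧ 0 < l C x := by
  have hB := h.rot.nonnegA hx
  have hC := h.rot.rot.nonnegA hx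
  refine ⟨hB.lt_of_ne fun h0 => hxΔ ?_, hC.lt_of_ne fun h0 => hxΔ ?_⟩
  · rw [h.rot.rot.eq_A hx hA h0.symm]; exact h.memC
  · rw [h.rot.eq_A hx h0.symm hA]; exact h.memB

theorem combo_A (a b c : ℝ) : combo l A B C a b c A = a := by
  rw [combo_apply, h.lAA, h.lBA, h.lCA]; ring
theorem combo_B (a b c : ℝ) : combo l A B C a b c B = b := by
  rw [combo_apply, h.lAB, h.lBB, h.lCB]; ring
theorem combo_C (a b c : ℝ) : combo l A B C a b c C = c := by
  rw [combo_apply, h.lAC, h.lBC, h.lCC]; ring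

theorem isInterior_pair_iff {v w : E} (hv : v ∈ convexHull ℝ (Δ : Set E))
    (hw : w ∈ convexHull ℝ (Δ : Set E)) :
    IsInterior Δ {v, w} ↔
      (0 < l A v ∨ 0 < l A w) ∧ (0 < l B v ∨ 0 < l B w) ∧ (0 < l C v ∨ 0 < l C w) := by
  rw [h.coord.isInterior_iff, h.forall_iff]
  · simp
  · rw [Finset.coe_pair]; rintro x (rfl | rfl) <;> assumption

theorem exists_separating {v w : E} (hv : v ∈ convexHull ℝ (Δ : Set E))
    (hw : w ∈ convexHull ℝ (Δ : Set E)) (hne : v ≠ w) :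
    ∃ φ : E →ᵃ[ℝ] ℝ, φ v = 0 ∧ φ w = 0 ∧ ∃ z ∈ convexHull ℝ (Δ : Set E), φ z ≠ 0 := by
  -- The coefficients are the cross product of the coordinate vectors of `v` and `w`. If they all
  -- vanish, the vectors are parallel; as both have coordinate sum one, they are equal.
  refine ⟨combo l A B C (l B v * l C w - l C v * l B w) (l C v * l A w - l A v * l C w)
    (l A v * l B w - l B v * l A w), ?_, ?_, ?_⟩
  · rw [combo_apply]; ring
  · rw [combo_apply]; ring
  · by_contra! hcon
    have h1 := hcon A h.hullA
    have h2 := hcon B h.rot.hullA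
    have h3 := hcon C h.rot.rot.hullA
    rw [h.combo_A] at h1
    rw [h.combo_B] at h2
    rw [h.combo_C] at h3
    refine hne (h.ext hv hw ?_ ?_)
    · linear_combination l A w * h.sum hv - l A v * h.sum hw + h3 - h2
    · linear_combination l B w * h.sum hv - l B v * h.sum hw + h1 - h3

theorem face_card_le (Γ : Triangulation Δ) {s : Finset E} (hs : s ∈ Γ.complex.faces) :
    s.card ≤ 3 := by
  have := (Γ.complex.indep hs).card_le_card_of_subset_affineSpan (t := Δ)
    ((Γ.face_subset hs).trans (convexHull_subset_affineSpan _))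
  refine this.trans ?_
  rw [h.eq]; exact Finset.card_le_three

theorem triangle_mem_facets (Γ : Triangulation Δ) {s : Finset E} (hs : s ∈ Γ.complex.faces)
    (h3 : s.card = 3) : s ∈ Γ.complex.facets :=
  ⟨hs, fun _ ht hst => Finset.eq_of_subset_of_card_le hst (h3 ▸ h.face_card_le Γ ht)⟩

/-! ### Triangles at an interior edge, and survival of interior edges -/

/-- On either side of an interior edge there is a triangle containing it. -/
theorem exists_triangle_pos (Γ : Triangulation Δ) {v w : E} (he : {v, w} ∈ interiorEdges Γ)
    (φ : E →ᵃ[ℝ] ℝ) (hφv : φ v = 0) (hφw : φ w = 0)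
    (hz : ∃ z ∈ convexHull ℝ (Δ : Set E), φ z ≠ 0) :
    ∃ a, {v, w, a} ∈ Γ.complex.faces ∧ 0 < φ a := by
  obtain ⟨hf, -, hint⟩ := he
  have hv := Γ.mem_of_mem_face hf (Finset.mem_insert_self v _)
  have hw := Γ.mem_of_mem_face hf (show w ∈ ({v, w} : Finset E) by simp)
  rw [h.isInterior_pair_iff hv hw] at hint
  -- All three coordinates are positive at the midpoint of an interior edge, so there is room around
  -- it in every direction.
  set x : E := AffineMap.lineMap v w (1 / 2 : ℝ) with hx
  have hxT : x ∈ convexHull ℝ (Δ : Set E) := by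
    refine h.coord.lineMap_mem hv hw fun i hi => ?_
    rw [map_lineMap_real]
    linarith [h.coord.nonneg hv hi, h.coord.nonneg hw hi]
  have hpos : 0 < l A x ∧ 0 < l B x ∧ 0 < l C x := by
    simp only [hx, map_lineMap_real]
    have := h.nonnegA hv; have := h.nonnegA hw
    have := h.rot.nonnegA hv; have := h.rot.nonnegA hw
    have := h.rot.rot.nonnegA hv; have := h.rot.rot.nonnegA hw
    obtain ⟨h1, h2, h3⟩ := hint
    refine ⟨?_, ?_, ?_⟩
    · rcases h1 with h1 | h1 <;> linarith
    · rcases h2 with h1 | h1 <;> linarith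
    · rcases h3 with h1 | h1 <;> linarith
  have hφx : φ x = 0 := by rw [hx, map_lineMap_real, hφv, hφw]; ring
  obtain ⟨y, hy, hφy⟩ : ∃ y ∈ convexHull ℝ (Δ : Set E), 0 < φ y := by
    obtain ⟨z, hz, hφz⟩ := hz
    rcases hφz.lt_or_gt with hlt | hgt
    -- When `φ z < 0`, step from `x` away from `z`. As the coordinates of `z` are at most `1`, a
    -- step bounded by every coordinate of `x` stays inside the triangle.
    · obtain ⟨ε, hε, hεA, hεB, hεC⟩ : ∃ ε : ℝ, 0 < ε ∧ ε ≤ l A x ∧ ε ≤ l B x ∧ ε ≤ l C x :=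
        ⟨min (l A x) (min (l B x) (l C x)), lt_min hpos.1 (lt_min hpos.2.1 hpos.2.2),
          min_le_left _ _, (min_le_right _ _).trans (min_le_left _ _),
          (min_le_right _ _).trans (min_le_right _ _)⟩
      refine ⟨AffineMap.lineMap x z (-ε), h.coord.lineMap_mem hxT hz ?_, ?_⟩
      · rw [h.forall_iff]
        simp only [map_lineMap_real]
        have a1 := h.nonnegA hz
        have a2 := h.rot.nonnegA hz
        have a3 := h.rot.rot.nonnegA hz
        have := h.sum hz
        refine ⟨?_, ?_, ?_⟩
        · nlinarith
        · nlinarith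
        · nlinarith
      · rw [map_lineMap_real, hφx]; nlinarith
    · exact ⟨z, hz, hgt⟩
  -- The face holding the germ from `x` towards `y` meets the relative interior of `{v, w}`, hence
  -- contains the edge, and it reaches into `φ > 0`.
  obtain ⟨σ, hσ, hxσ, δ, hδ, -, hδσ⟩ := Γ.exists_face_germ hxT hy
  obtain ⟨hvσ, hwσ⟩ := edge_subset_of_lineMap_mem hf hσ (by norm_num) (by norm_num) hxσ
  obtain ⟨a, haσ, ha⟩ := exists_pos_of_mem_hull hδσ φ (by
    rw [map_lineMap_real, hφx]; simp only [sub_zero, zero_add]; positivity)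
  exact ⟨a, triangle_of_mem hσ hvσ hwσ haσ, ha⟩

theorem exists_two_triangles (Γ : Triangulation Δ) {v w : E} (he : {v, w} ∈ interiorEdges Γ) :
    ∃ a b, a ≠ b ∧ a ≠ v ∧ a ≠ w ∧ b ≠ v ∧ b ≠ w ∧ {v, w, a} ∈ Γ.complex.faces ∧
      {v, w, b} ∈ Γ.complex.faces := by
  have hne : v ≠ w := by
    rintro rfl
    simpa using he.2.1
  obtain ⟨φ, hv, hw, z, hz, hφz⟩ := h.exists_separating
    (Γ.mem_of_mem_face he.1 (Finset.mem_insert_self v _))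
    (Γ.mem_of_mem_face he.1 (show w ∈ ({v, w} : Finset E) by simp)) hne
  obtain ⟨a, ha, hφa⟩ := h.exists_triangle_pos Γ he φ hv hw ⟨z, hz, hφz⟩
  obtain ⟨b, hb, hφb⟩ := h.exists_triangle_pos Γ he (-φ) (by simp [hv]) (by simp [hw])
    ⟨z, hz, by simpa using hφz⟩
  have hφb' : φ b < 0 := by simpa using hφb
  refine ⟨a, b, ?_, ?_, ?_, ?_, ?_, ha, hb⟩ <;> rintro rfl <;> linarith

/-- Interior edges survive conical facet refinements. -/
theorem interiorEdges_subset_of_refinement {Γ Γ' : Triangulation Δ}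
    (hr : IsConicalFacetRefinement Γ Γ') : interiorEdges Γ ⊆ interiorEdges Γ' := by
  intro e he
  obtain ⟨v, w, hne, rfl⟩ := Finset.card_eq_two.1 he.2.1
  obtain ⟨G, ⟨-, -, hG⟩, -⟩ := hr
  obtain ⟨a, b, hab, hav, haw, hbv, hbw, ha, hb⟩ := h.exists_two_triangles Γ he
  have key : ∀ c, c ≠ v → c ≠ w → {v, w, c} ∈ Γ.complex.faces → {v, w, c} ≠ G →
      {v, w} ∈ interiorEdges Γ' := by
    intro c hcv hcw hc hcG
    have htriv := hG _ (h.triangle_mem_facets Γ hc (Finset.card_eq_three.2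
      ⟨v, w, c, hne, hcv.symm, hcw.symm, rfl⟩)) hcG
    have : ({v, w} : Finset E) ∈ (restrict Γ'.complex {v, w, c}).faces := by
      rw [htriv]
      exact ⟨by simp, by intro x; simp; tauto⟩
    exact ⟨this.1, he.2⟩
  -- At most one of the two triangles at the edge is the refined facet `G`; the other one keeps its
  -- faces.
  by_cases hG1 : ({v, w, a} : Finset E) = G
  · refine key b hbv hbw hb fun hG2 => ?_
    have : a ∈ ({v, w, b} : Finset E) := by rw [hG2, ← hG1]; simp
    simp [hav, haw, hab] at this
  · exact key a hav haw ha hG1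

theorem interiorEdges_subset_of_iterated {Γ Γ' : Triangulation Δ}
    (hr : IsIteratedConical Γ Γ') : interiorEdges Γ ⊆ interiorEdges Γ' := by
  induction hr with
  | refl => exact subset_rfl
  | tail _ hstep ih => exact ih.trans (h.interiorEdges_subset_of_refinement hstep)

theorem mem_interiorEdges_iff {Γ : Triangulation Δ} {v w : E} (hne : v ≠ w) :
    {v, w} ∈ interiorEdges Γ ↔ {v, w} ∈ Γ.complex.faces ∧
      (0 < l A v ∨ 0 < l A w) ∧ (0 < l B v ∨ 0 < l B w) ∧ (0 < l C v ∨ 0 < l C w) := by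
  constructor
  · intro he
    exact ⟨he.1, (h.isInterior_pair_iff (Γ.mem_of_mem_face he.1 (by simp))
      (Γ.mem_of_mem_face he.1 (by simp))).1 he.2.2⟩
  · rintro ⟨he, hpos⟩
    exact ⟨he, Finset.card_pair hne, (h.isInterior_pair_iff (Γ.mem_of_mem_face he (by simp))
      (Γ.mem_of_mem_face he (by simp))).2 hpos⟩

theorem of_mem_openSegment {x : E} (hx : x ∈ openSegment ℝ B C) :
    x ∈ convexHull ℝ (Δ : Set E) ∧ l A x = 0 ∧ 0 < l B x ∧ 0 < l C x := by
  have hT : x ∈ convexHull ℝ (Δ : Set E) :=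
    (convex_convexHull ℝ _).segment_subset h.rot.hullA h.rot.rot.hullA
      (openSegment_subset_segment _ _ _ hx)
  rw [openSegment_eq_image_lineMap] at hx
  obtain ⟨t, ⟨h0, h1⟩, rfl⟩ := hx
  refine ⟨hT, ?_⟩
  simp only [map_lineMap_real, h.lAB, h.lAC, h.lBB, h.lBC, h.lCB, h.lCC]
  refine ⟨by ring, by linarith, by linarith⟩

theorem mem_openSegment {x : E} (hx : x ∈ convexHull ℝ (Δ : Set E)) (hA : l A x = 0)
    (hB : 0 < l B x) (hC : 0 < l C x) : x ∈ openSegment ℝ B C := by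
  have := h.sum hx
  refine ⟨l B x, l C x, hB, hC, by linarith, ?_⟩
  have := h.repr hx
  rwa [hA, zero_smul, zero_add] at this

end Labels

/-! ### Invariants separating the two families -/

/-- A set of edges contains the three edges of a triangle. -/
def HasTriangle (S : Set (Finset E)) : Prop :=
  ∃ u v w : E, u ≠ v ∧ v ≠ w ∧ w ≠ u ∧ {u, v} ∈ S ∧ {v, w} ∈ S ∧ {w, u} ∈ S

theorem exists_labels {Δ : Finset E} (hΔ : AffineIndependent ℝ ((↑) : Δ → E))
    (hcard : Δ.card = 3) : ∃ l A B C, Labels Δ l A B C := by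
  obtain ⟨l, hl⟩ := exists_isCoord hΔ
  obtain ⟨A, B, C, hAB, hAC, hBC, rfl⟩ := Finset.card_eq_three.1 hcard
  exact ⟨l, A, B, C, hl, rfl, hAB, hBC, hAC.symm⟩

namespace Labels

variable {Δ : Finset E} {l : E → E →ᵃ[ℝ] ℝ} {A B C : E} (h : Labels Δ l A B C)
include h

theorem card : Δ.card = 3 := by
  rw [h.eq]; exact Finset.card_eq_three.2 ⟨A, B, C, h.ab, h.ca.symm, h.bc, rfl⟩

theorem relabel {a b c : E} (hΔ : Δ = {a, b, c}) : Labels Δ l a b c := by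
  have hc := h.card
  rw [hΔ] at hc
  refine ⟨h.coord, hΔ, ?_, ?_, ?_⟩
  · rintro rfl
    have : ({a, a, c} : Finset E).card ≤ 2 := by simpa using Finset.card_le_two (a := a) (b := c)
    omega
  · rintro rfl
    have : ({a, b, b} : Finset E).card ≤ 2 := by simpa using Finset.card_le_two (a := a) (b := b)
    omega
  · rintro rfl
    have : ({c, b, c} : Finset E).card ≤ 2 := by
      rw [Finset.insert_eq_of_mem (by simp)]; exact Finset.card_le_two
    omega

theorem isTriforce_hasTriangle {Γ : Triangulation Δ} (ht : IsTriforce Γ.complex Δ) :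
    HasTriangle (interiorEdges Γ) := by
  obtain ⟨a, b, c, p, q, r, hΔ, hp, hq, hr, hfac⟩ := ht
  have h' := h.relabel hΔ
  obtain ⟨-, pa, pb, pc⟩ := h'.of_mem_openSegment hp
  obtain ⟨-, qb, qc, qa⟩ := h'.rot.of_mem_openSegment hq
  obtain ⟨-, rc, ra, rb⟩ := h'.rot.rot.of_mem_openSegment hr
  have hf : ({p, q, r} : Finset E) ∈ Γ.complex.faces := by
    apply SimplicialComplex.facets_subset
    rw [hfac]; simp
  have hpq : p ≠ q := by rintro rfl; linarith
  have hqr : q ≠ r := by rintro rfl; linarith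
  have hrp : r ≠ p := by rintro rfl; linarith
  refine ⟨p, q, r, hpq, hqr, hrp, ?_, ?_, ?_⟩
  · exact (h'.mem_interiorEdges_iff hpq).2 ⟨edge_of_mem hf (by simp) (by simp),
      Or.inr qa, Or.inl pb, Or.inl pc⟩
  · exact (h'.mem_interiorEdges_iff hqr).2 ⟨edge_of_mem hf (by simp) (by simp),
      Or.inr ra, Or.inr rb, Or.inl qc⟩
  · exact (h'.mem_interiorEdges_iff hrp).2 ⟨edge_of_mem hf (by simp) (by simp),
      Or.inl ra, Or.inl rb, Or.inr pc⟩

theorem fromTriforce_hasTriangle {Γ : Triangulation Δ} (hΓ : FromTriforce Γ) :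
    HasTriangle (interiorEdges Γ) := by
  obtain ⟨Γ₀, h0, hiter⟩ := hΓ
  obtain ⟨u, v, w, huv, hvw, hwu, e1, e2, e3⟩ := h.isTriforce_hasTriangle h0
  have hs := h.interiorEdges_subset_of_iterated hiter
  exact ⟨u, v, w, huv, hvw, hwu, hs e1, hs e2, hs e3⟩

/-- If all vertices are vertices of the triangle, then the triangle is a face. -/
theorem mem_faces_of_vertices {Γ : Triangulation Δ} (hv : ∀ v, {v} ∈ Γ.complex.faces → v ∈ Δ) :
    Δ ∈ Γ.complex.faces := by
  -- All coordinates of the barycentre are positive, so a face spanned by vertices of `Δ` that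
  -- contains it must be all of `Δ`.
  have hx : (1 / 3 : ℝ) • A + (1 / 3 : ℝ) • B + (1 / 3 : ℝ) • C ∈ convexHull ℝ (Δ : Set E) := by
    have := (convex_convexHull ℝ (Δ : Set E)).sum_mem (t := Finset.univ)
      (w := fun _ : Fin 3 => (1 / 3 : ℝ)) (z := ![A, B, C]) (by intros; norm_num)
      (by simp) (by
        intro i _
        fin_cases i
        · exact h.hullA
        · exact h.rot.hullA
        · exact h.rot.rot.hullA)
    simpa [Fin.sum_univ_three] using this
  obtain ⟨σ, hσ, hxσ⟩ := Γ.exists_face hx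
  have hσΔ : σ ⊆ Δ := fun v hvσ => hv v (vertex_of_mem hσ hvσ)
  have key := (h.coord.mem_face_iff hσΔ hx).1 hxσ
  have hval : ∀ i ∈ Δ, l i ((1 / 3 : ℝ) • A + (1 / 3 : ℝ) • B + (1 / 3 : ℝ) • C) = 1 / 3 := by
    intro i hi
    have := h.coord.apply_sum (c := fun _ => (1 / 3 : ℝ)) (by
      rw [Finset.sum_const, h.card]; norm_num) hi
    rw [h.eq, Finset.sum_insert (by simp [h.ab, h.ca.symm]), Finset.sum_pair h.bc,
      ← add_assoc] at this
    exact this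
  have : σ = Δ := by
    refine Finset.Subset.antisymm hσΔ fun i hi => ?_
    by_contra hiσ
    have := key i hi hiσ
    rw [hval i hi] at this
    norm_num at this
  exact this ▸ hσ

theorem interiorEdges_eq_empty_of_vertices {Γ : Triangulation Δ}
    (hv : ∀ v, {v} ∈ Γ.complex.faces → v ∈ Δ) : interiorEdges Γ = ∅ := by
  rw [Set.eq_empty_iff_forall_notMem]
  rintro e ⟨hf, hc, hint⟩
  have he : e ⊆ Δ := fun v hve => hv v (vertex_of_mem hf hve)
  have := hint e he (subset_convexHull ℝ _)
  rw [this, h.card] at hc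
  omega

theorem isTrivial_of_vertices {Γ : Triangulation Δ}
    (hv : ∀ v, {v} ∈ Γ.complex.faces → v ∈ Δ) : IsTrivial Γ.complex Δ := by
  ext s
  constructor
  · intro hs
    exact ⟨SimplicialComplex.nonempty_of_mem_faces hs, fun v hvs => hv v (vertex_of_mem hs hvs)⟩
  · rintro ⟨hne, hs⟩
    exact Γ.complex.down_closed (h.mem_faces_of_vertices hv) hs hne

/-- The facet refined is `Δ` itself, and the result is a cone over a subdivided side with apex `a ∈
Δ`. A new vertex `p` on that side yields the interior edge `{a, p}`; if there is none, the cone has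
no new vertex at all. -/
theorem vertices_or_mem_of_refinement {Γ Γ' : Triangulation Δ}
    (hr : IsConicalFacetRefinement Γ Γ') (hv : ∀ v, {v} ∈ Γ.complex.faces → v ∈ Δ) :
    (∀ v, {v} ∈ Γ'.complex.faces → v ∈ Δ) ∨ ∃ e ∈ interiorEdges Γ', ∃ a ∈ e, a ∈ Δ := by
  obtain ⟨G, ⟨hG, -, -⟩, a, haG, hcone⟩ := hr
  have hGΔ : G = Δ := hG.2 (h.mem_faces_of_vertices hv)
    fun v hvG => hv v (vertex_of_mem hG.1 hvG)
  subst hGΔ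
  by_cases hall : ∀ v, {v} ∈ (restrict Γ'.complex (G.erase a)).faces → v ∈ G
  · left
    intro v hvΓ
    have hv1 : {v} ∈ (restrict Γ'.complex G).faces := ⟨hvΓ, Γ'.face_subset hvΓ⟩
    rw [hcone] at hv1
    rcases hv1 with (hv1 | hv1) | ⟨s, hs, hv1⟩
    · exact hall v hv1
    · have : v = a := by simpa using hv1
      rwa [this]
    · have : a ∈ ({v} : Finset E) := by rw [hv1]; simp
      rw [Finset.mem_singleton] at this
      rwa [← this]
  · right
    push Not at hall
    obtain ⟨p, hp, hpG⟩ := hall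
    have hpT := Γ'.mem_of_mem_face hp.1 (Finset.mem_singleton_self p)
    have hpa : l a p = 0 := (h.coord.mem_face_iff (Finset.erase_subset _ _) hpT).1
      (hp.2 (by simp)) a haG (by simp)
    have hf : {a, p} ∈ (restrict Γ'.complex G).faces := by
      rw [hcone]; exact Or.inr ⟨{p}, hp, rfl⟩
    obtain ⟨b, c, hl⟩ : ∃ b c, Labels G l a b c := by
      have := haG
      rw [h.eq] at this
      simp only [Finset.mem_insert, Finset.mem_singleton] at this
      rcases this with rfl | rfl | rfl
      · exact ⟨_, _, h⟩
      · exact ⟨_, _, h.rot⟩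
      · exact ⟨_, _, h.rot.rot⟩
    obtain ⟨hb, hc⟩ := hl.side_pos hpT hpG hpa
    have hne : a ≠ p := by rintro rfl; exact hpG haG
    refine ⟨{a, p}, (hl.mem_interiorEdges_iff hne).2 ⟨hf.1, Or.inl ?_, Or.inr hb, Or.inr hc⟩,
      a, by simp, haG⟩
    rw [hl.lAA]; norm_num

/-- The second alternative persists because interior edges survive; the triforce family never
satisfies either one. -/
theorem fromTrivial_vertices_or_mem {Γ : Triangulation Δ} (hΓ : FromTrivial Γ) :
    (∀ v, {v} ∈ Γ.complex.faces → v ∈ Δ) ∨ ∃ e ∈ interiorEdges Γ, ∃ a ∈ e, a ∈ Δ := by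
  obtain ⟨Γ₀, h0, hiter⟩ := hΓ
  induction hiter with
  | refl =>
    left
    intro v hv
    rw [h0] at hv
    simpa using hv.2
  | tail _ hstep ih =>
    rcases ih with ih | ⟨e, he, a, ha, haΔ⟩
    · exact h.vertices_or_mem_of_refinement hstep ih
    · exact Or.inr ⟨e, h.interiorEdges_subset_of_refinement hstep he, a, ha, haΔ⟩

end Labels

/-! ### Flaps: merging the two triangles at a vertex of degree one -/

theorem affineIndependent_of_weights {s : Finset E}
    (hs : ∀ c : E → ℝ, ∑ i ∈ s, c i = 0 → ∑ i ∈ s, c i • i = 0 → ∀ i ∈ s, c i = 0) :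
    AffineIndependent ℝ ((↑) : s → E) := by
  rw [affineIndependent_iff_of_fintype]
  intro w hw hw' i
  rw [Finset.univ.weightedVSub_eq_linear_combination hw] at hw'
  have := hs (fun x => if hx : x ∈ s then w ⟨x, hx⟩ else 0)
    (by rw [← Finset.sum_coe_sort, ← hw]; simp)
    (by rw [← Finset.sum_coe_sort, ← hw']; simp) i i.2
  simpa using this

theorem sum_mul_map_eq_zero {s : Finset E} {c : E → ℝ} (hc : ∑ i ∈ s, c i = 0)
    (hc' : ∑ i ∈ s, c i • i = 0) (φ : E →ᵃ[ℝ] ℝ) : ∑ i ∈ s, c i * φ i = 0 := by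
  have e : ∀ i, φ i = φ.linear i + φ 0 := fun i => congrFun (AffineMap.decomp φ) i
  have h2 := congrArg φ.linear hc'
  rw [map_sum, map_zero] at h2
  simp only [map_smul, smul_eq_mul] at h2
  rw [Finset.sum_congr rfl fun i _ => by rw [e i, mul_add], Finset.sum_add_distrib,
    ← Finset.sum_mul, hc, h2]
  ring

theorem segment_split {u v w : E} (hv : v ∈ segment ℝ u w) :
    segment ℝ u w = segment ℝ v u ∪ segment ℝ v w := by
  rw [segment_eq_image_lineMap] at hv
  obtain ⟨t, ⟨h0, h1⟩, rfl⟩ := hv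
  apply Set.Subset.antisymm
  · intro x hx
    rw [segment_eq_image_lineMap] at hx
    obtain ⟨r, ⟨r0, r1⟩, rfl⟩ := hx
    have hseg : ∀ a b : ℝ, segment ℝ (AffineMap.lineMap u w a : E) (AffineMap.lineMap u w b) =
        (AffineMap.lineMap u w : ℝ →ᵃ[ℝ] E) '' segment ℝ a b :=
      fun a b => (image_segment ℝ (AffineMap.lineMap u w : ℝ →ᵃ[ℝ] E) a b).symm
    rcases le_total r t with hrt | hrt
    · left
      have := hseg t 0
      rw [AffineMap.lineMap_apply_zero] at this
      rw [this, segment_symm, segment_eq_Icc h0]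
      exact ⟨r, ⟨r0, hrt⟩, rfl⟩
    · right
      have := hseg t 1
      rw [AffineMap.lineMap_apply_one] at this
      rw [this, segment_eq_Icc h1]
      exact ⟨r, ⟨hrt, r1⟩, rfl⟩
  · have hv : AffineMap.lineMap u w t ∈ segment ℝ u w := by
      rw [segment_eq_image_lineMap]; exact ⟨t, ⟨h0, h1⟩, rfl⟩
    exact Set.union_subset
      ((convex_segment u w).segment_subset hv (left_mem_segment _ _ _))
      ((convex_segment u w).segment_subset hv (right_mem_segment _ _ _))

theorem hull_pair_split {u v w : E} (hv : v ∈ segment ℝ u w) :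
    convexHull ℝ (({u, w} : Finset E) : Set E) =
      convexHull ℝ (({v, u} : Finset E) : Set E) ∪ convexHull ℝ (({v, w} : Finset E) : Set E) := by
  simp only [Finset.coe_pair, convexHull_pair]
  exact segment_split hv

theorem hull_triangle_split {a u v w : E} (hv : v ∈ segment ℝ u w) :
    convexHull ℝ (({a, u, w} : Finset E) : Set E) =
      convexHull ℝ (({a, v, u} : Finset E) : Set E) ∪
        convexHull ℝ (({a, v, w} : Finset E) : Set E) := by
  simp only [Finset.coe_insert, Finset.coe_singleton]
  rw [convexHull_insert (Set.insert_nonempty u {w}), convexHull_insert (Set.insert_nonempty v {u}),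
    convexHull_insert (Set.insert_nonempty v {w}), convexHull_pair, convexHull_pair,
    convexHull_pair, segment_split hv, convexJoin_union_right]

/-- The star of a vertex `v` on a side of the triangle consists of two triangles on either side of
the edge `{a, v}`. -/
structure IsFlap {Δ : Finset E} (Γ : Triangulation Δ) (l : E → E →ᵃ[ℝ] ℝ) (A B v a u w : E) :
    Prop where
  triangle_left : {a, v, u} ∈ Γ.complex.faces
  triangle_right : {a, v, w} ∈ Γ.complex.faces
  apex : 0 < l A a
  mid : l A v = 0
  left : l A u = 0
  right : l A w = 0
  left_lt : l B v < l B u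
  lt_right : l B w < l B v
  star : ∀ s ∈ Γ.complex.faces, v ∈ s → s ⊆ {a, v, u} ∨ s ⊆ {a, v, w}

namespace Labels

variable {Δ : Finset E} {l : E → E →ᵃ[ℝ] ℝ} {A B C : E} (h : Labels Δ l A B C)
include h

/-- Apart from `a`, every neighbour of `v` lies on the side containing `v`. The triangles on the two
sides of `{v, a}` provide one neighbour in each direction of the side, and there is at most one per
direction. -/
theorem exists_flap (Γ : Triangulation Δ) {v a : E} (hvA : l A v = 0) (hvB : 0 < l B v)
    (hvC : 0 < l C v) (he : {v, a} ∈ interiorEdges Γ)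
    (huniq : ∀ y, {v, y} ∈ interiorEdges Γ → y = a) :
    ∃ u w, IsFlap Γ l A B v a u w := by
  have hva : v ≠ a := by rintro rfl; simpa using he.2.1
  have hv := Γ.mem_of_mem_face he.1 (Finset.mem_insert_self v _)
  have ha := Γ.mem_of_mem_face he.1 (show a ∈ ({v, a} : Finset E) by simp)
  have haA : 0 < l A a := by
    rcases ((h.mem_interiorEdges_iff hva).1 he).2.1 with h1 | h1
    · linarith
    · exact h1
  have hside : ∀ y, {v, y} ∈ Γ.complex.faces → y ≠ v → y ≠ a → l A y = 0 := by
    intro y hy hyv hya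
    by_contra h0
    exact hya (huniq y ((h.mem_interiorEdges_iff hyv.symm).2 ⟨hy,
      Or.inr ((h.nonnegA (Γ.mem_of_mem_face hy (by simp))).lt_of_ne' h0), Or.inl hvB, Or.inl hvC⟩))
  have hsv := h.sum hv
  -- The cross product form vanishing on the line `v a`, simplified by `l A v = 0`. On the side it
  -- is a positive multiple of `l B - l B v`, so its sign orders that side relative to `v`.
  set φ := combo l A B C (l B v * l C a - l C v * l B a) (l C v * l A a) (-(l B v * l A a)) with hφ
  have hφv : φ v = 0 := by rw [hφ, combo_apply, hvA]; ring
  have hφa : φ a = 0 := by rw [hφ, combo_apply]; ring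
  have hφs : ∀ y ∈ convexHull ℝ (Δ : Set E), l A y = 0 → φ y = l A a * (l B y - l B v) := by
    intro y hy hyA
    have := h.sum hy
    have e1 : l C y = 1 - l B y := by linarith
    have e2 : l C v = 1 - l B v := by linarith
    rw [hφ, combo_apply, hyA, e1, e2]; ring
  have hφB : φ B = l C v * l A a := h.combo_B _ _ _
  have hφB' : φ B ≠ 0 := by rw [hφB]; positivity
  obtain ⟨u, hu, hφu⟩ := h.exists_triangle_pos Γ he φ hφv hφa ⟨B, h.rot.hullA, hφB'⟩
  obtain ⟨w, hw, hφw⟩ := h.exists_triangle_pos Γ he (-φ) (by simp [hφv]) (by simp [hφa])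
    ⟨B, h.rot.hullA, by simpa using hφB'⟩
  replace hφw : φ w < 0 := by simpa using hφw
  have huv : u ≠ v := by rintro rfl; linarith
  have hua : u ≠ a := by rintro rfl; linarith
  have hwv : w ≠ v := by rintro rfl; linarith
  have hwa : w ≠ a := by rintro rfl; linarith
  have huA := hside u (edge_of_mem hu (by simp) (by simp)) huv hua
  have hwA := hside w (edge_of_mem hw (by simp) (by simp)) hwv hwa
  have huT := Γ.mem_of_mem_face hu (show u ∈ ({v, a, u} : Finset E) by simp)
  have hwT := Γ.mem_of_mem_face hw (show w ∈ ({v, a, w} : Finset E) by simp)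
  rw [hφs u huT huA] at hφu
  rw [hφs w hwT hwA] at hφw
  have hu1 : l B v < l B u := by
    have := pos_of_mul_pos_right hφu haA.le; linarith
  have hw1 : l B w < l B v := by nlinarith
  have hvu : {v, u} ∈ Γ.complex.faces := edge_of_mem hu (by simp) (by simp)
  have hvw : {v, w} ∈ Γ.complex.faces := edge_of_mem hw (by simp) (by simp)
  refine ⟨u, w, by rwa [Finset.insert_comm] at hu, by rwa [Finset.insert_comm] at hw, haA, hvA, huA,
    hwA, hu1, hw1, ?_⟩
  -- `v` lies between `u` and `w`, so `{u, w}` cannot be a face. Hence no face at `v` contains both.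
  have hnot : {u, w} ∉ Γ.complex.faces := by
    intro huw
    have hpos : 0 < l B u - l B w := by linarith
    have hmem : v ∈ convexHull ℝ (({u, w} : Finset E) : Set E) := by
      rw [Finset.coe_pair, convexHull_pair, segment_eq_image_lineMap]
      refine ⟨(l B u - l B v) / (l B u - l B w), ⟨?_, ?_⟩, ?_⟩
      · apply div_nonneg <;> linarith
      · rw [div_le_one hpos]; linarith
      · refine (h.eq_lineMap huT hwT hv ?_ ?_).symm
        · rw [hvA, huA, hwA]; ring
        · field_simp; ring
    have := vertex_mem_of_mem_hull (vertex_of_mem hvu (by simp)) huw hmem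
    simp only [Finset.mem_insert, Finset.mem_singleton] at this
    rcases this with h1 | h1
    · exact huv h1.symm
    · exact hwv h1.symm
  intro s hs hvs
  have hsub : ∀ y ∈ s, y = a ∨ y = v ∨ y = u ∨ y = w := by
    intro y hy
    by_cases hyv : y = v
    · simp [hyv]
    by_cases hya : y = a
    · simp [hya]
    have hvy := edge_of_mem hs hvs hy
    have hyA := hside y hvy hyv hya
    have hyT := Γ.mem_of_mem_face hs hy
    rcases lt_trichotomy (l B y) (l B v) with hlt | heq | hgt
    · right; right; right
      refine (eq_of_edges_same_ray hvw hvy hwv.symm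
        (s := (l B y - l B v) / (l B w - l B v)) (div_pos_of_neg_of_neg (by linarith) (by linarith))
        (h.eq_lineMap hv hwT hyT ?_ ?_)).symm
      · rw [hvA, hyA, hwA]; ring
      · have : l B w - l B v ≠ 0 := by linarith
        field_simp; ring
    · exact absurd (h.ext hyT hv (by rw [hyA, hvA]) heq) hyv
    · right; right; left
      refine (eq_of_edges_same_ray hvu hvy huv.symm
        (s := (l B y - l B v) / (l B u - l B v)) (div_pos (by linarith) (by linarith))
        (h.eq_lineMap hv huT hyT ?_ ?_)).symm
      · rw [hvA, hyA, huA]; ring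
      · have : l B u - l B v ≠ 0 := by linarith
        field_simp; ring
  by_cases hus : u ∈ s
  · have hws : w ∉ s := fun hws => hnot (edge_of_mem hs hus hws)
    left; intro y hy
    rcases hsub y hy with rfl | rfl | rfl | rfl
    · simp
    · simp
    · simp
    · exact absurd hy hws
  · right; intro y hy
    rcases hsub y hy with rfl | rfl | rfl | rfl
    · simp
    · simp
    · exact absurd hy hus
    · simp

end Labels

namespace IsFlap

variable {Δ : Finset E} {l : E → E →ᵃ[ℝ] ℝ} {A B C v a u w : E} {Γ : Triangulation Δ}
  (hf : IsFlap Γ l A B v a u w)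
include hf

theorem ne_av : a ≠ v := by rintro rfl; linarith [hf.apex, hf.mid]
theorem ne_au : a ≠ u := by rintro rfl; linarith [hf.apex, hf.left]
theorem ne_aw : a ≠ w := by rintro rfl; linarith [hf.apex, hf.right]
theorem ne_vu : v ≠ u := by rintro rfl; linarith [hf.left_lt]
theorem ne_vw : v ≠ w := by rintro rfl; linarith [hf.lt_right]
theorem ne_uw : u ≠ w := by rintro rfl; linarith [hf.left_lt, hf.lt_right]

theorem mid_mem_segment (h : Labels Δ l A B C) : v ∈ segment ℝ u w := by
  have hpos : 0 < l B u - l B w := by linarith [hf.left_lt, hf.lt_right]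
  rw [segment_eq_image_lineMap]
  refine ⟨(l B u - l B v) / (l B u - l B w), ⟨?_, ?_⟩, ?_⟩
  · apply div_nonneg <;> linarith [hf.left_lt, hf.lt_right]
  · rw [div_le_one hpos]; linarith [hf.left_lt, hf.lt_right]
  · refine (h.eq_lineMap (Γ.mem_of_mem_face hf.triangle_left (by simp))
      (Γ.mem_of_mem_face hf.triangle_right (by simp))
      (Γ.mem_of_mem_face hf.triangle_left (by simp)) ?_ ?_).symm
    · rw [hf.mid, hf.left, hf.right]; ring
    · field_simp; ring

theorem pair_notMem (h : Labels Δ l A B C) : {u, w} ∉ Γ.complex.faces := by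
  intro huw
  have := vertex_mem_of_mem_hull (vertex_of_mem (v := v) hf.triangle_left (by simp)) huw
    (by rw [Finset.coe_pair, convexHull_pair]; exact hf.mid_mem_segment h)
  simp only [Finset.mem_insert, Finset.mem_singleton] at this
  rcases this with h1 | h1
  · exact hf.ne_vu h1
  · exact hf.ne_vw h1

theorem affineIndependent : AffineIndependent ℝ ((↑) : ({a, u, w} : Finset E) → E) := by
  refine affineIndependent_of_weights fun c hc hc' => ?_
  have hA := sum_mul_map_eq_zero hc hc' (l A)
  have hB := sum_mul_map_eq_zero hc hc' (l B)
  have hn : a ∉ ({u, w} : Finset E) := by simp [hf.ne_au, hf.ne_aw]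
  rw [Finset.sum_insert hn, Finset.sum_pair hf.ne_uw] at hc hA hB
  rw [hf.left, hf.right, mul_zero, mul_zero, add_zero, add_zero] at hA
  have ha : c a = 0 := by
    rcases mul_eq_zero.1 hA with h1 | h1
    · exact h1
    · exact absurd h1 hf.apex.ne'
  rw [ha] at hc hB
  have hu : c u = 0 := by
    have : c u * (l B u - l B w) = 0 := by linear_combination hB - l B w * hc
    rcases mul_eq_zero.1 this with h1 | h1
    · exact h1
    · linarith [hf.left_lt, hf.lt_right]
  have hw : c w = 0 := by linarith
  simp [ha, hu, hw]

/-- Removing the middle vertex of a flap and merging its two triangles gives a triangulation. -/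
theorem exists_merge (h : Labels Δ l A B C) : ∃ Γ₁ : Triangulation Δ, ∀ s, s ∈ Γ₁.complex.faces ↔
    (s ∈ Γ.complex.faces ∧ v ∉ s) ∨ s = {u, w} ∨ s = {a, u, w} := by
  have hseg := hf.mid_mem_segment h
  have hav := hf.ne_av
  have hvu := hf.ne_vu
  have hvw := hf.ne_vw
  -- Each new face is covered by two old faces whose vertices other than `v` belong to it.
  -- Intersections with old faces avoiding `v`, and containment in `Δ`, are thereby inherited from
  -- `Γ`.
  have hsplit : ∀ t : Finset E, t = {u, w} ∨ t = {a, u, w} → ∃ t₁ t₂, t₁ ∈ Γ.complex.faces ∧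
      t₂ ∈ Γ.complex.faces ∧ convexHull ℝ (t : Set E) =
        convexHull ℝ (t₁ : Set E) ∪ convexHull ℝ (t₂ : Set E) ∧
      (∀ x ∈ t₁, x = v ∨ x ∈ t) ∧ (∀ x ∈ t₂, x = v ∨ x ∈ t) := by
    rintro t (rfl | rfl)
    · exact ⟨{v, u}, {v, w}, edge_of_mem hf.triangle_left (by simp) (by simp),
        edge_of_mem hf.triangle_right (by simp) (by simp), hull_pair_split hseg,
        by simp, by simp⟩
    · exact ⟨{a, v, u}, {a, v, w}, hf.triangle_left, hf.triangle_right, hull_triangle_split hseg,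
        by simp, by simp⟩
  have hinter : ∀ s t : Finset E, s ∈ Γ.complex.faces → v ∉ s → (t = {u, w} ∨ t = {a, u, w}) →
      convexHull ℝ (s : Set E) ∩ convexHull ℝ (t : Set E) ⊆ convexHull ℝ ((s : Set E) ∩ t) := by
    intro s t hs hvs ht
    obtain ⟨t₁, t₂, h1, h2, hull, hsub1, hsub2⟩ := hsplit t ht
    rw [hull, Set.inter_union_distrib_left]
    refine Set.union_subset ((Γ.complex.inter_subset_convexHull hs h1).trans (convexHull_mono ?_))
      ((Γ.complex.inter_subset_convexHull hs h2).trans (convexHull_mono ?_))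
    · rintro x ⟨hxs, hx⟩
      rcases hsub1 x hx with rfl | hx
      · exact absurd hxs hvs
      · exact ⟨hxs, hx⟩
    · rintro x ⟨hxs, hx⟩
      rcases hsub2 x hx with rfl | hx
      · exact absurd hxs hvs
      · exact ⟨hxs, hx⟩
  have hnew : ∀ t : Finset E, t = {u, w} ∨ t = {a, u, w} → t ⊆ {a, u, w} := by
    rintro t (rfl | rfl)
    · exact Finset.subset_insert _ _
    · exact subset_rfl
  let K : SimplicialComplex ℝ E :=
    { faces := {s | (s ∈ Γ.complex.faces ∧ v ∉ s) ∨ s = {u, w} ∨ s = {a, u, w}}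
      isRelLowerSet_faces := by
        intro s hs
        refine ⟨?_, ?_⟩
        · rcases hs with hs | rfl | rfl
          · exact SimplicialComplex.nonempty_of_mem_faces hs.1
          · simp
          · simp
        · intro t hts ht
          have hts' : t ⊆ s := hts
          rcases hs with ⟨hs, hvs⟩ | hs
          · exact Or.inl ⟨Γ.complex.down_closed hs hts' ht, fun hvt => hvs (hts' hvt)⟩
          · have hta := hts'.trans (hnew s hs)
            have hvt : v ∉ t := fun hvt => by
              have := hta hvt
              simp [hav.symm, hvu, hvw] at this
            -- A subset of `{a, u, w}` that misses `u` or `w` is a face of one of the two old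
            -- triangles; only `{u, w}` and the whole triangle are new.
            by_cases hu : u ∈ t
            · by_cases hw : w ∈ t
              · right
                by_cases ha : a ∈ t
                · right
                  refine Finset.Subset.antisymm hta ?_
                  intro x; simp only [Finset.mem_insert, Finset.mem_singleton]
                  rintro (rfl | rfl | rfl) <;> assumption
                · left
                  refine Finset.Subset.antisymm ?_ ?_
                  · intro x hx
                    have := hta hx
                    rw [Finset.mem_insert] at this
                    rcases this with rfl | h1
                    · exact absurd hx ha
                    · exact h1
                  · intro x; simp only [Finset.mem_insert, Finset.mem_singleton]
                    rintro (rfl | rfl) <;> assumption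
              · left
                refine ⟨Γ.complex.down_closed hf.triangle_left ?_ ht, hvt⟩
                intro x hx
                have := hta hx
                simp only [Finset.mem_insert, Finset.mem_singleton] at this ⊢
                rcases this with rfl | rfl | rfl
                · simp
                · simp
                · exact absurd hx hw
            · left
              refine ⟨Γ.complex.down_closed hf.triangle_right ?_ ht, hvt⟩
              intro x hx
              have := hta hx
              simp only [Finset.mem_insert, Finset.mem_singleton] at this ⊢
              rcases this with rfl | rfl | rfl
              · simp
              · exact absurd hx hu
              · simp
      indep := by
        rintro s (hs | hs)
        · exact Γ.complex.indep hs.1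
        · exact hf.affineIndependent.mono (hnew s hs)
      inter_subset_convexHull := by
        rintro s t (hs | hs) (ht | ht)
        · exact Γ.complex.inter_subset_convexHull hs.1 ht.1
        · exact hinter s t hs.1 hs.2 ht
        · rw [Set.inter_comm, Set.inter_comm (s : Set E)]
          exact hinter t s ht.1 ht.2 hs
        · have := hf.affineIndependent.convexHull_inter (hnew s hs) (hnew t ht)
          exact this.ge }
  have hold : ∀ s ∈ K.faces, convexHull ℝ (s : Set E) ⊆ convexHull ℝ (Δ : Set E) := by
    rintro s (hs | hs)
    · exact Γ.hull_subset hs.1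
    · obtain ⟨t₁, t₂, h1, h2, hull, -, -⟩ := hsplit s hs
      rw [hull]
      exact Set.union_subset (Γ.hull_subset h1) (Γ.hull_subset h2)
  refine ⟨⟨K, ?_, ?_⟩, fun s => Iff.rfl⟩
  · refine (Γ.finite_faces.union (Set.toFinite {{u, w}, {a, u, w}})).subset ?_
    rintro s (hs | hs)
    · exact Or.inl hs.1
    · right; simpa using hs
  · apply Set.Subset.antisymm
    · exact Set.iUnion₂_subset hold
    · intro x hx
      obtain ⟨σ, hσ, hxσ⟩ := Γ.exists_face hx
      rw [SimplicialComplex.mem_space_iff]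
      by_cases hvσ : v ∈ σ
      · refine ⟨{a, u, w}, Or.inr (Or.inr rfl), ?_⟩
        rw [hull_triangle_split hseg]
        rcases hf.star σ hσ hvσ with h1 | h1
        · exact Or.inl (convexHull_mono (Finset.coe_subset.2 h1) hxσ)
        · exact Or.inr (convexHull_mono (Finset.coe_subset.2 h1) hxσ)
      · exact ⟨σ, Or.inl ⟨hσ, hvσ⟩, hxσ⟩

theorem isConicalFacetRefinement (h : Labels Δ l A B C) {Γ₁ : Triangulation Δ}
    (hΓ₁ : ∀ s, s ∈ Γ₁.complex.faces ↔
      (s ∈ Γ.complex.faces ∧ v ∉ s) ∨ s = {u, w} ∨ s = {a, u, w}) :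
    IsConicalFacetRefinement Γ₁ Γ := by
  have hseg := hf.mid_mem_segment h
  have hvu := hf.ne_vu
  have hvw := hf.ne_vw
  have hau := hf.ne_au
  have haw := hf.ne_aw
  have huw := hf.ne_uw
  have hav := hf.ne_av
  have hG : ({a, u, w} : Finset E) ∈ Γ₁.complex.facets :=
    h.triangle_mem_facets Γ₁ ((hΓ₁ _).2 (Or.inr (Or.inr rfl)))
      (Finset.card_eq_three.2 ⟨a, u, w, hau, haw, huw, rfl⟩)
  have hvert : ∀ x, {x} ∈ Γ.complex.faces → x ∈ convexHull ℝ (({a, u, w} : Finset E) : Set E) →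
      x = a ∨ x = v ∨ x = u ∨ x = w := by
    intro x hx hxG
    rw [hull_triangle_split hseg] at hxG
    rcases hxG with hxG | hxG
    · have := vertex_mem_of_mem_hull hx hf.triangle_left hxG
      simp only [Finset.mem_insert, Finset.mem_singleton] at this
      tauto
    · have := vertex_mem_of_mem_hull hx hf.triangle_right hxG
      simp only [Finset.mem_insert, Finset.mem_singleton] at this
      tauto
  have hbase : ∀ s ∈ Γ.complex.faces, a ∉ s →
      (s : Set E) ⊆ convexHull ℝ (({a, u, w} : Finset E) : Set E) →
      (s : Set E) ⊆ convexHull ℝ (({u, w} : Finset E) : Set E) := by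
    intro s hs ha hsG x hx
    have hmem : x = v ∨ x = u ∨ x = w := by
      rcases hvert x (vertex_of_mem hs hx) (hsG hx) with rfl | h1
      · exact absurd hx ha
      · exact h1
    rw [Finset.coe_pair, convexHull_pair]
    rcases hmem with rfl | rfl | rfl
    · exact hseg
    · exact left_mem_segment _ _ _
    · exact right_mem_segment _ _ _
  have hpairG : convexHull ℝ (({u, w} : Finset E) : Set E) ⊆
      convexHull ℝ (({a, u, w} : Finset E) : Set E) :=
    convexHull_mono (Finset.coe_subset.2 (Finset.subset_insert _ _))
  refine ⟨{a, u, w}, ⟨hG, ?_, ?_⟩, a, by simp, ?_⟩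
  · intro s hs
    rcases (hΓ₁ s).1 hs with hs | rfl | rfl
    · exact ⟨{s}, by simpa using hs.1, by simp⟩
    · refine ⟨{{v, u}, {v, w}}, ?_, ?_⟩
      · rintro t (rfl | rfl)
        · exact edge_of_mem hf.triangle_left (by simp) (by simp)
        · exact edge_of_mem hf.triangle_right (by simp) (by simp)
      · rw [Set.biUnion_pair]; exact hull_pair_split hseg
    · refine ⟨{{a, v, u}, {a, v, w}}, ?_, ?_⟩
      · rintro t (rfl | rfl)
        · exact hf.triangle_left
        · exact hf.triangle_right
      · rw [Set.biUnion_pair]; exact hull_triangle_split hseg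
  -- A facet other than `{a, u, w}` was already a face of `Γ`, so the vertices of `Γ` in its hull
  -- are its own vertices.
  · intro H hH hHG
    have hHΓ : H ∈ Γ.complex.faces := by
      rcases (hΓ₁ H).1 hH.1 with h1 | rfl | rfl
      · exact h1.1
      · exact absurd (hH.2 hG.1 (Finset.subset_insert _ _)) hHG
      · exact absurd rfl hHG
    ext s
    constructor
    · rintro ⟨hs, hsH⟩
      exact ⟨SimplicialComplex.nonempty_of_mem_faces hs, fun x hx =>
        vertex_mem_of_mem_hull (vertex_of_mem hs hx) hHΓ (hsH hx)⟩
    · rintro ⟨hne, hsH⟩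
      exact ⟨Γ.complex.down_closed hHΓ hsH hne,
        (Finset.coe_subset.2 hsH).trans (subset_convexHull ℝ _)⟩
  · have herase : ({a, u, w} : Finset E).erase a = {u, w} := by
      ext x
      simp only [Finset.mem_erase, Finset.mem_insert, Finset.mem_singleton]
      constructor
      · tauto
      · rintro (rfl | rfl)
        · exact ⟨hau.symm, by simp⟩
        · exact ⟨haw.symm, by simp⟩
    rw [herase]
    ext s
    constructor
    · rintro ⟨hs, hsG⟩
      -- Faces of `Γ` inside the merged triangle that avoid `a` lie on its base `{u, w}`; the others
      -- are `{a}` or arise from such a face by adding `a`.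
      by_cases ha : a ∈ s
      · by_cases hsa : s = {a}
        · exact Or.inl (Or.inr hsa)
        · right
          have hne : (s.erase a).Nonempty := by
            rw [Finset.nonempty_iff_ne_empty]
            intro h0
            exact hsa (by rw [← Finset.insert_erase ha, h0]; rfl)
          have hsub : s.erase a ⊆ s := Finset.erase_subset _ _
          have hs' := Γ.complex.down_closed hs hsub hne
          exact ⟨s.erase a, ⟨hs', hbase _ hs' (by simp)
            ((Finset.coe_subset.2 hsub).trans hsG)⟩, (Finset.insert_erase ha).symm⟩
      · exact Or.inl (Or.inl ⟨hs, hbase s hs ha hsG⟩)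
    · rintro ((⟨hs, hsL⟩ | rfl) | ⟨t, ⟨ht, htL⟩, rfl⟩)
      · exact ⟨hs, hsL.trans hpairG⟩
      · exact ⟨vertex_of_mem hf.triangle_left (by simp),
          by simpa using subset_convexHull ℝ _ (Set.mem_insert a {u, w})⟩
      · have htG := htL.trans hpairG
        have hlist : ∀ x ∈ t, x = v ∨ x = u ∨ x = w := by
          intro x hx
          have h1 := htL hx
          rw [hull_pair_split hseg] at h1
          rcases h1 with h1 | h1
          · have := vertex_mem_of_mem_hull (vertex_of_mem ht hx)
              (edge_of_mem hf.triangle_left (v := v) (w := u) (by simp) (by simp)) h1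
            simp only [Finset.mem_insert, Finset.mem_singleton] at this
            tauto
          · have := vertex_mem_of_mem_hull (vertex_of_mem ht hx)
              (edge_of_mem hf.triangle_right (v := v) (w := w) (by simp) (by simp)) h1
            simp only [Finset.mem_insert, Finset.mem_singleton] at this
            tauto
        -- A base face cannot contain both ends, so joining it to `a` stays within one of the two
        -- old triangles.
        have hboth : u ∈ t → w ∉ t := fun hu hw => hf.pair_notMem h (edge_of_mem ht hu hw)
        refine ⟨?_, ?_⟩
        · by_cases hu : u ∈ t
          · refine Γ.complex.down_closed hf.triangle_left ?_ (by simp)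
            intro x hx
            rw [Finset.mem_insert] at hx
            rcases hx with rfl | hx
            · simp
            · rcases hlist x hx with rfl | rfl | rfl
              · simp
              · simp
              · exact absurd hx (hboth hu)
          · refine Γ.complex.down_closed hf.triangle_right ?_ (by simp)
            intro x hx
            rw [Finset.mem_insert] at hx
            rcases hx with rfl | hx
            · simp
            · rcases hlist x hx with rfl | rfl | rfl
              · simp
              · exact absurd hx hu
              · simp
        · intro x hx
          rw [Finset.mem_coe, Finset.mem_insert] at hx
          rcases hx with rfl | hx
          · exact subset_convexHull ℝ _ (by simp)
          · exact htG hx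

end IsFlap

/-! ### Coefficients of the local h-polynomial -/

/-- The vertices of a triangulation that are not vertices of the triangulated simplex. -/
def newVertices {Δ : Finset E} (Γ : Triangulation Δ) : Set E :=
  {v | {v} ∈ Γ.complex.faces ∧ v ∉ Δ}

theorem finite_vertices {Δ : Finset E} (Γ : Triangulation Δ) :
    {v | {v} ∈ Γ.complex.faces}.Finite :=
  Γ.finite_faces.preimage Finset.singleton_injective.injOn

theorem finite_newVertices {Δ : Finset E} (Γ : Triangulation Δ) : (newVertices Γ).Finite :=
  (finite_vertices Γ).subset fun _ hv => hv.1

theorem finite_interiorEdges {Δ : Finset E} (Γ : Triangulation Δ) : (interiorEdges Γ).Finite :=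
  Γ.finite_faces.subset fun _ he => he.1

/-- A triangulation without interior vertices that has as many interior edges as new vertices. -/
structure IsBalanced {Δ : Finset E} (Γ : Triangulation Δ) (l : E → E →ᵃ[ℝ] ℝ) : Prop where
  boundary : ∀ v, {v} ∈ Γ.complex.faces → ∃ i ∈ Δ, l i v = 0
  ncard_eq : (interiorEdges Γ).ncard = (newVertices Γ).ncard

theorem faceCount_one (K : SimplicialComplex ℝ E) :
    faceCount K 1 = {v | {v} ∈ K.faces}.ncard := by
  rw [faceCount, if_neg one_ne_zero,
    ← Set.ncard_image_of_injective {v | {v} ∈ K.faces} Finset.singleton_injective]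
  refine congrArg Set.ncard (Set.ext fun s => ?_)
  simp only [Set.mem_ofPred_eq, Set.mem_image, Finset.card_eq_one]
  constructor
  · rintro ⟨hs, v, rfl⟩; exact ⟨v, hs, rfl⟩
  · rintro ⟨v, hv, rfl⟩; exact ⟨hv, v, rfl⟩

theorem hPoly_zero (K : SimplicialComplex ℝ E) : hPoly K 0 = 1 := by
  simp [hPoly, faceCount]

theorem hPoly_one (K : SimplicialComplex ℝ E) :
    hPoly K 1 = 1 + C ((faceCount K 1 : ℤ) - 1) * X := by
  have : faceCount K 0 = 1 := if_pos rfl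
  simp only [hPoly, Finset.sum_range_succ, Finset.sum_range_zero, this, map_sub, map_one,
    Nat.cast_one]
  ring

theorem hPoly_two (K : SimplicialComplex ℝ E) :
    hPoly K 2 = 1 + C ((faceCount K 1 : ℤ) - 2) * X +
      C (1 - (faceCount K 1 : ℤ) + faceCount K 2) * X ^ 2 := by
  have : faceCount K 0 = 1 := if_pos rfl
  simp only [hPoly, Finset.sum_range_succ, Finset.sum_range_zero, this, map_sub, map_add, map_one,
    Nat.cast_one, map_ofNat]
  ring

theorem hPoly_three (K : SimplicialComplex ℝ E) :
    hPoly K 3 = 1 + C ((faceCount K 1 : ℤ) - 3) * X +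
      C (3 - 2 * (faceCount K 1 : ℤ) + faceCount K 2) * X ^ 2 +
      C (-1 + (faceCount K 1 : ℤ) - faceCount K 2 + faceCount K 3) * X ^ 3 := by
  have : faceCount K 0 = 1 := if_pos rfl
  simp only [hPoly, Finset.sum_range_succ, Finset.sum_range_zero, this, map_sub, map_add, map_one,
    Nat.cast_one, map_ofNat, map_mul, map_neg]
  ring

theorem restrict_self {Δ : Finset E} (Γ : Triangulation Δ) : (restrict Γ.complex Δ).faces = Γ.complex.faces := by
  ext s
  exact ⟨fun hs => hs.1, fun hs => ⟨hs, Γ.face_subset hs⟩⟩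

namespace Labels

variable {Δ : Finset E} {l : E → E →ᵃ[ℝ] ℝ} {A B C : E} (h : Labels Δ l A B C)
include h

/-- `A` is an extreme point: `l B + l C` is positive on the hull of any face without `A`, but
vanishes at `A`. -/
theorem vertex_mem_faces (Γ : Triangulation Δ) : {A} ∈ Γ.complex.faces := by
  obtain ⟨σ, hσ, hA⟩ := Γ.exists_face h.hullA
  suffices hAσ : A ∈ σ from vertex_of_mem hσ hAσ
  by_contra hAσ
  have hsub : convexHull ℝ (σ : Set E) ⊆ (l B + l C : E →ᵃ[ℝ] ℝ) ⁻¹' Set.Ioi 0 := by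
    refine convexHull_min (fun v hv => ?_) ((convex_Ioi 0).affine_preimage _)
    have hvT := Γ.mem_of_mem_face hσ hv
    have hB := h.rot.nonnegA hvT
    have hC := h.rot.rot.nonnegA hvT
    show 0 < l B v + l C v
    by_contra hcon
    have : v = A := h.eq_A hvT (by linarith) (by linarith)
    exact hAσ (this ▸ hv)
  have : 0 < l B A + l C A := hsub hA
  rw [h.lBA, h.lCA] at this
  norm_num at this

theorem localH_eq (Γ : Triangulation Δ) :
    localH Γ = hPoly (restrict Γ.complex Δ) 3 - (hPoly (restrict Γ.complex {A, B}) 2 +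
      hPoly (restrict Γ.complex {B, C}) 2 + hPoly (restrict Γ.complex {C, A}) 2) +
      (hPoly (restrict Γ.complex {A}) 1 + hPoly (restrict Γ.complex {B}) 1 +
      hPoly (restrict Γ.complex {C}) 1) - hPoly (restrict Γ.complex ∅) 0 := by
  have hab := h.ab
  have hbc := h.bc
  have hca := h.ca
  have hAC : ({A, C} : Finset E).card = 2 := Finset.card_pair hca.symm
  have e1 : Δ.powerset = (insert A (insert B (insert C (∅ : Finset E)))).powerset := by
    rw [h.eq]; rfl
  have hA : A ∉ insert B (insert C (∅ : Finset E)) := by simp [hab, hca.symm]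
  have hB : B ∉ insert C (∅ : Finset E) := by simp [hbc]
  have hC : C ∉ (∅ : Finset E) := by simp
  rw [localH, e1, Finset.sum_powerset_insert hA, Finset.sum_powerset_insert hB,
    Finset.sum_powerset_insert hB, Finset.sum_powerset_insert hC, Finset.sum_powerset_insert hC,
    Finset.sum_powerset_insert hC, Finset.sum_powerset_insert hC]
  have h3 : ({A, B, C} : Finset E).card = 3 := h.eq ▸ h.card
  simp only [Finset.powerset_empty, Finset.sum_singleton, insert_empty_eq, Finset.card_empty,
    Finset.card_singleton, h3, Finset.card_pair hab, Finset.card_pair hbc, hAC, h.card]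
  rw [Finset.pair_comm C A, congrArg (restrict Γ.complex) h.eq]
  ring

theorem mem_hull_side {x : E} (hx : x ∈ convexHull ℝ (Δ : Set E)) :
    x ∈ convexHull ℝ (({B, C} : Finset E) : Set E) ↔ l A x = 0 := by
  rw [h.coord.mem_face_iff (by rw [h.eq]; exact Finset.subset_insert _ _) hx]
  constructor
  · intro hx; exact hx A h.memA (by simp [h.ab, h.ca.symm])
  · intro hA i hi hi'
    rw [h.eq] at hi
    rw [Finset.mem_insert] at hi
    rcases hi with rfl | hi
    · exact hA
    · exact absurd hi hi'

theorem faceCount_side_one (Γ : Triangulation Δ) :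
    faceCount (restrict Γ.complex {B, C}) 1 = 2 + {v ∈ newVertices Γ | l A v = 0}.ncard := by
  rw [faceCount_one]
  have : {v | {v} ∈ (restrict Γ.complex {B, C}).faces} =
      (({B, C} : Finset E) : Set E) ∪ {v ∈ newVertices Γ | l A v = 0} := by
    ext v
    constructor
    · rintro ⟨hv, hv'⟩
      rw [Finset.coe_singleton, Set.singleton_subset_iff] at hv'
      have hvT := Γ.mem_of_mem_face hv (Finset.mem_singleton_self v)
      rw [h.mem_hull_side hvT] at hv'
      by_cases hvΔ : v ∈ Δ
      · left
        rw [h.eq, Finset.mem_insert] at hvΔ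
        rcases hvΔ with rfl | hvΔ
        · rw [h.lAA] at hv'; norm_num at hv'
        · exact hvΔ
      · exact Or.inr ⟨⟨hv, hvΔ⟩, hv'⟩
    · rintro (hv | ⟨⟨hv, hvΔ⟩, hA⟩)
      · refine ⟨?_, by simpa using subset_convexHull ℝ _ hv⟩
        simp only [Finset.mem_coe, Finset.mem_insert, Finset.mem_singleton] at hv
        rcases hv with rfl | rfl
        · exact h.rot.vertex_mem_faces Γ
        · exact h.rot.rot.vertex_mem_faces Γ
      · refine ⟨hv, ?_⟩
        rw [Finset.coe_singleton, Set.singleton_subset_iff,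
          h.mem_hull_side (Γ.mem_of_mem_face hv (Finset.mem_singleton_self v))]
        exact hA
  rw [this, Set.ncard_union_eq _ (Finset.finite_toSet _)
    ((finite_newVertices Γ).subset fun _ hv => hv.1), Set.ncard_coe_finset, Finset.card_pair h.bc]
  · rw [Set.disjoint_left]
    intro v hv hv'
    refine hv'.1.2 ?_
    rw [h.eq]; exact Finset.mem_insert_of_mem hv

theorem faceCount_whole_one (Γ : Triangulation Δ) :
    faceCount (restrict Γ.complex Δ) 1 = 3 + (newVertices Γ).ncard := by
  rw [faceCount_one, restrict_self]
  have : {v | {v} ∈ Γ.complex.faces} = (Δ : Set E) ∪ newVertices Γ := by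
    ext v
    constructor
    · intro hv
      by_cases hvΔ : v ∈ Δ
      · exact Or.inl hvΔ
      · exact Or.inr ⟨hv, hvΔ⟩
    · rintro (hv | hv)
      · rw [Finset.mem_coe, h.eq] at hv
        simp only [Finset.mem_insert, Finset.mem_singleton] at hv
        rcases hv with rfl | rfl | rfl
        · exact h.vertex_mem_faces Γ
        · exact h.rot.vertex_mem_faces Γ
        · exact h.rot.rot.vertex_mem_faces Γ
      · exact hv.1
  rw [this, Set.ncard_union_eq _ (Finset.finite_toSet _) (finite_newVertices Γ),
    Set.ncard_coe_finset, h.card]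
  · rw [Set.disjoint_left]
    intro v hv hv'
    exact hv'.2 hv

theorem faceCount_vertex_one (Γ : Triangulation Δ) :
    faceCount (restrict Γ.complex {A}) 1 = 1 := by
  rw [faceCount_one, Set.ncard_eq_one]
  refine ⟨A, ?_⟩
  ext v
  constructor
  · rintro ⟨-, hv⟩
    simpa using hv
  · rintro rfl
    exact ⟨h.vertex_mem_faces Γ, by simp⟩

theorem faceCount_side_two (Γ : Triangulation Δ) :
    faceCount (restrict Γ.complex {B, C}) 2 =
      {e | (e ∈ Γ.complex.faces ∧ e.card = 2) ∧ ∀ v ∈ e, l A v = 0}.ncard := by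
  rw [faceCount, if_neg two_ne_zero]
  congr 1
  ext e
  constructor
  · rintro ⟨⟨he, hsub⟩, hc⟩
    exact ⟨⟨he, hc⟩, fun v hv => (h.mem_hull_side (Γ.mem_of_mem_face he hv)).1 (hsub hv)⟩
  · rintro ⟨⟨he, hc⟩, hA⟩
    exact ⟨⟨he, fun v hv => (h.mem_hull_side (Γ.mem_of_mem_face he hv)).2 (hA v hv)⟩, hc⟩

theorem not_two_sides {Γ : Triangulation Δ} {e : Finset E} (he : e ∈ Γ.complex.faces)
    (hc : e.card = 2) (hA : ∀ v ∈ e, l A v = 0) (hB : ∀ v ∈ e, l B v = 0) : False := by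
  have : e ⊆ {C} := fun v hv => by
    rw [Finset.mem_singleton]
    exact h.rot.rot.eq_A (Γ.mem_of_mem_face he hv) (hA v hv) (hB v hv)
  have := Finset.card_le_card this
  rw [hc, Finset.card_singleton] at this
  omega

/-- An edge that is not interior lies on a side, and on only one, because two sides share just a
point. -/
theorem faceCount_whole_two (Γ : Triangulation Δ) :
    faceCount (restrict Γ.complex Δ) 2 = (interiorEdges Γ).ncard +
      faceCount (restrict Γ.complex {B, C}) 2 + faceCount (restrict Γ.complex {C, A}) 2 +
      faceCount (restrict Γ.complex {A, B}) 2 := by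
  rw [h.faceCount_side_two, h.rot.faceCount_side_two, h.rot.rot.faceCount_side_two,
    faceCount, if_neg two_ne_zero, restrict_self]
  have hfin : {e | e ∈ Γ.complex.faces ∧ e.card = 2}.Finite :=
    Γ.finite_faces.subset fun _ he => he.1
  have hsub : ∀ p : Finset E → Prop,
      {e | (e ∈ Γ.complex.faces ∧ e.card = 2) ∧ p e}.Finite :=
    fun p => hfin.subset fun _ he => he.1
  rw [← Set.ncard_union_eq _ (finite_interiorEdges Γ) (hsub _),
    ← Set.ncard_union_eq _ ((finite_interiorEdges Γ).union (hsub _)) (hsub _),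
    ← Set.ncard_union_eq _ (((finite_interiorEdges Γ).union (hsub _)).union (hsub _)) (hsub _)]
  · congr 1
    ext e
    constructor
    · rintro ⟨he, hc⟩
      by_cases hint : IsInterior Δ e
      · exact Or.inl (Or.inl (Or.inl ⟨he, hc, hint⟩))
      · rw [h.coord.isInterior_iff (Γ.face_subset he)] at hint
        push Not at hint
        obtain ⟨i, hi, hv⟩ := hint
        have h0 : ∀ v ∈ e, l i v = 0 := fun v hve =>
          le_antisymm (hv v hve) (h.coord.nonneg (Γ.mem_of_mem_face he hve) hi)
        rw [h.eq] at hi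
        simp only [Finset.mem_insert, Finset.mem_singleton] at hi
        rcases hi with rfl | rfl | rfl
        · exact Or.inl (Or.inl (Or.inr ⟨⟨he, hc⟩, h0⟩))
        · exact Or.inl (Or.inr ⟨⟨he, hc⟩, h0⟩)
        · exact Or.inr ⟨⟨he, hc⟩, h0⟩
    · rintro (((he | he) | he) | he)
      · exact ⟨he.1, he.2.1⟩
      · exact he.1
      · exact he.1
      · exact he.1
  · rw [Set.disjoint_left]
    rintro e ((he | ⟨⟨he, hc⟩, h1⟩) | ⟨⟨he, hc⟩, h1⟩) ⟨-, h2⟩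
    · obtain ⟨v, hv, hpos⟩ := (h.coord.isInterior_iff (Γ.face_subset he.1)).1 he.2.2 C h.memC
      linarith [h2 v hv]
    · exact h.swap.not_two_sides he hc h1 h2
    · exact h.rot.not_two_sides he hc h1 h2
  · rw [Set.disjoint_left]
    rintro e (he | ⟨⟨he, hc⟩, h1⟩) ⟨-, h2⟩
    · obtain ⟨v, hv, hpos⟩ := (h.coord.isInterior_iff (Γ.face_subset he.1)).1 he.2.2 B h.memB
      linarith [h2 v hv]
    · exact h.not_two_sides he hc h1 h2
  · rw [Set.disjoint_left]
    rintro e he ⟨-, h2⟩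
    obtain ⟨v, hv, hpos⟩ := (h.coord.isInterior_iff (Γ.face_subset he.1)).1 he.2.2 A h.memA
    linarith [h2 v hv]

theorem isBalanced {Γ : Triangulation Δ} (hΓ : localH Γ = 0) : IsBalanced Γ l := by
  have hΓ' := hΓ
  rw [h.localH_eq, hPoly_zero, hPoly_one, hPoly_one, hPoly_one, hPoly_two, hPoly_two, hPoly_two,
    hPoly_three, h.faceCount_vertex_one, h.rot.faceCount_vertex_one,
    h.rot.rot.faceCount_vertex_one, h.faceCount_side_one, h.rot.faceCount_side_one,
    h.rot.rot.faceCount_side_one, h.faceCount_whole_one, h.faceCount_whole_two] at hΓ'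
  -- The coefficient of `x` compares all new vertices with those on the sides. That of `x^2` gives
  -- interior edges minus twice the new vertices plus the new vertices on the sides.
  have h1 := congrArg (fun p => p.coeff 1) hΓ'
  have h2 := congrArg (fun p => p.coeff 2) hΓ'
  simp only [coeff_add, coeff_sub, coeff_C_mul, coeff_X_pow, coeff_X, coeff_one, coeff_zero]
    at h1 h2
  norm_num at h1 h2
  have fin : ∀ p : E → Prop, {v ∈ newVertices Γ | p v}.Finite :=
    fun p => (finite_newVertices Γ).subset fun _ hv => hv.1
  have hdisj : ∀ {A B C : E}, Labels Δ l A B C → ∀ v ∈ newVertices Γ, l A v = 0 → l B v = 0 →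
      False := by
    intro A B C h v hv hA hB
    have := h.side_pos (Γ.mem_of_mem_face hv.1 (Finset.mem_singleton_self v)) hv.2 hA
    linarith [this.1]
  have hunion : ({v ∈ newVertices Γ | l A v = 0} ∪ {v ∈ newVertices Γ | l B v = 0} ∪
      {v ∈ newVertices Γ | l C v = 0}).ncard = {v ∈ newVertices Γ | l A v = 0}.ncard +
      {v ∈ newVertices Γ | l B v = 0}.ncard + {v ∈ newVertices Γ | l C v = 0}.ncard := by
    rw [Set.ncard_union_eq _ ((fin _).union (fin _)) (fin _), Set.ncard_union_eq _ (fin _) (fin _)]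
    · rw [Set.disjoint_left]
      rintro v ⟨hv, hv1⟩ ⟨-, hv2⟩
      exact hdisj h v hv hv1 hv2
    · rw [Set.disjoint_left]
      rintro v (⟨hv, hv1⟩ | ⟨hv, hv1⟩) ⟨-, hv2⟩
      · exact hdisj h.swap v hv hv1 hv2
      · exact hdisj h.rot v hv hv1 hv2
  -- New vertices on different sides are distinct, so equality of the counts forces every new vertex
  -- onto a side.
  have heq : {v ∈ newVertices Γ | l A v = 0} ∪ {v ∈ newVertices Γ | l B v = 0} ∪
      {v ∈ newVertices Γ | l C v = 0} = newVertices Γ := by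
    refine Set.eq_of_subset_of_ncard_le ?_ ?_ (finite_newVertices Γ)
    · rintro v ((hv | hv) | hv) <;> exact hv.1
    · rw [hunion]; omega
  constructor
  · intro v hv
    by_cases hvΔ : v ∈ Δ
    · rw [h.eq] at hvΔ
      simp only [Finset.mem_insert, Finset.mem_singleton] at hvΔ
      rcases hvΔ with rfl | rfl | rfl
      · exact ⟨B, h.memB, h.lBA⟩
      · exact ⟨A, h.memA, h.lAB⟩
      · exact ⟨A, h.memA, h.lAC⟩
    · have : v ∈ newVertices Γ := ⟨hv, hvΔ⟩
      rw [← heq] at this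
      rcases this with (hv | hv) | hv
      · exact ⟨A, h.memA, hv.2⟩
      · exact ⟨B, h.memB, hv.2⟩
      · exact ⟨C, h.memC, hv.2⟩
  · omega

end Labels

/-! ### Degree count and rigidity -/

/-- A graph with at most as many edges as vertices in `N`, all of whose vertices in `N` have
degree at least two, has all its edges in `N` and is regular of degree two. -/
theorem two_regular_of_card {α : Type*} {S : Finset (Finset α)} {N : Finset α} (hS : ∀ e ∈ S, e.card = 2)
    (hcard : S.card ≤ N.card) (hdeg : ∀ v ∈ N, 2 ≤ (S.filter fun e => v ∈ e).card) :
    (∀ e ∈ S, e ⊆ N) ∧ ∀ v ∈ N, (S.filter fun e => v ∈ e).card = 2 := by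
  -- Count incidences: at least `2` per vertex of `N`, at most `2` per edge. With no more edges than
  -- vertices, all these inequalities are equalities.
  have hdc : ∑ v ∈ N, (S.filter fun e => v ∈ e).card = ∑ e ∈ S, (N.filter fun v => v ∈ e).card :=
    Finset.sum_card_bipartiteAbove_eq_sum_card_bipartiteBelow (fun v e => v ∈ e)
  have hle : ∀ e ∈ S, (N.filter fun v => v ∈ e).card ≤ 2 := fun e he => by
    rw [← hS e he]
    exact Finset.card_le_card fun v hv => (Finset.mem_filter.1 hv).2
  have h1 : ∑ _v ∈ N, 2 ≤ ∑ v ∈ N, (S.filter fun e => v ∈ e).card := Finset.sum_le_sum hdeg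
  have h2 : ∑ e ∈ S, (N.filter fun v => v ∈ e).card ≤ ∑ _e ∈ S, 2 := Finset.sum_le_sum hle
  have h3 : ∑ _e ∈ S, 2 ≤ ∑ _v ∈ N, 2 := by
    simp only [Finset.sum_const, smul_eq_mul]; omega
  constructor
  · intro e he v hv
    have := (Finset.sum_eq_sum_iff_of_le hle).1 (by omega) e he
    have heq : (N.filter fun v => v ∈ e) = e :=
      Finset.eq_of_subset_of_card_le (fun v hv => (Finset.mem_filter.1 hv).2)
        (by rw [this, hS e he])
    rw [← heq] at hv
    exact (Finset.mem_filter.1 hv).1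
  · intro v hv
    exact ((Finset.sum_eq_sum_iff_of_le hdeg).1 (by omega) v hv).symm

/-- The internal edge graph has the new vertices as its vertices and is regular of degree two. -/
structure IsRigid {Δ : Finset E} (Γ : Triangulation Δ) : Prop where
  subset_new : ∀ e ∈ interiorEdges Γ, ∀ v ∈ e, v ∈ newVertices Γ
  exists_ne : ∀ v ∈ newVertices Γ, ∀ x, ∃ y, y ≠ x ∧ {v, y} ∈ interiorEdges Γ
  two_neighbours : ∀ v x y z, x ≠ y → {v, x} ∈ interiorEdges Γ → {v, y} ∈ interiorEdges Γ →
    {v, z} ∈ interiorEdges Γ → z = x ∨ z = y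

theorem ne_of_mem_interiorEdges {Δ : Finset E} {Γ : Triangulation Δ} {v w : E}
    (h : {v, w} ∈ interiorEdges Γ) : v ≠ w := by
  rintro rfl; simpa using h.2.1

theorem pair_right_injective {α : Type*} (v : α) :
    Function.Injective fun w : α => ({v, w} : Finset α) := by
  intro x y hxy
  have hxy : ({v, x} : Finset α) = {v, y} := hxy
  have hx : x ∈ ({v, y} : Finset α) := by rw [← hxy]; simp
  have hy : y ∈ ({v, x} : Finset α) := by rw [hxy]; simp
  simp only [Finset.mem_insert, Finset.mem_singleton] at hx hy
  rcases hx with rfl | hx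
  · rcases hy with hy | hy <;> exact hy.symm
  · exact hx

namespace Labels

variable {Δ : Finset E} {l : E → E →ᵃ[ℝ] ℝ} {A B C : E} (h : Labels Δ l A B C)
include h

/-- The germ from `v` towards `A` lies in a face having a vertex off the side of `v`; joining `v` to
that vertex gives an interior edge. -/
theorem exists_interiorEdge (Γ : Triangulation Δ) {v : E} (hv : {v} ∈ Γ.complex.faces)
    (hA : l A v = 0) (hB : 0 < l B v) (hC : 0 < l C v) : ∃ a, {v, a} ∈ interiorEdges Γ := by
  have hvT := Γ.mem_of_mem_face hv (Finset.mem_singleton_self v)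
  obtain ⟨σ, hσ, hvσ, δ, hδ, -, hδσ⟩ := Γ.exists_face_germ hvT h.hullA
  obtain ⟨a, ha, hpos⟩ := exists_pos_of_mem_hull hδσ (l A) (by
    rw [map_lineMap_real, hA, h.lAA]; linarith)
  have hne : v ≠ a := by rintro rfl; linarith
  exact ⟨a, (h.mem_interiorEdges_iff hne).2
    ⟨edge_of_mem hσ (vertex_mem_of_mem_hull hv hσ hvσ) ha, Or.inr hpos, Or.inl hB, Or.inl hC⟩⟩

theorem exists_labels_opposite {i : E} (hi : i ∈ Δ) : ∃ b c, Labels Δ l i b c := by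
  rw [h.eq] at hi
  simp only [Finset.mem_insert, Finset.mem_singleton] at hi
  rcases hi with rfl | rfl | rfl
  · exact ⟨_, _, h⟩
  · exact ⟨_, _, h.rot⟩
  · exact ⟨_, _, h.rot.rot⟩

theorem exists_labels_side {Γ : Triangulation Δ} (hb : IsBalanced Γ l) {v : E}
    (hv : v ∈ newVertices Γ) : ∃ a b c, Labels Δ l a b c ∧ l a v = 0 ∧ 0 < l b v ∧ 0 < l c v := by
  obtain ⟨i, hi, hiv⟩ := hb.boundary v hv.1
  obtain ⟨b, c, hl⟩ := h.exists_labels_opposite hi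
  exact ⟨i, b, c, hl, hiv,
    hl.side_pos (Γ.mem_of_mem_face hv.1 (Finset.mem_singleton_self v)) hv.2 hiv⟩

/-- Without a new vertex of degree one, all new vertices have degree at least two. Since edges and
new vertices are equally many, the double count leaves no slack. -/
theorem exists_unique_or_isRigid {Γ : Triangulation Δ} (hb : IsBalanced Γ l) :
    (∃ v ∈ newVertices Γ, ∃ a, {v, a} ∈ interiorEdges Γ ∧
      ∀ y, {v, y} ∈ interiorEdges Γ → y = a) ∨ IsRigid Γ := by
  by_cases hex : ∃ v ∈ newVertices Γ, ∃ a, {v, a} ∈ interiorEdges Γ ∧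
      ∀ y, {v, y} ∈ interiorEdges Γ → y = a
  · exact Or.inl hex
  right
  push Not at hex
  have hne : ∀ v ∈ newVertices Γ, ∀ x, ∃ y, y ≠ x ∧ {v, y} ∈ interiorEdges Γ := by
    intro v hv x
    obtain ⟨a, b, c, hl, h1, h2, h3⟩ := h.exists_labels_side hb hv
    obtain ⟨y, hy⟩ := hl.exists_interiorEdge Γ hv.1 h1 h2 h3
    by_cases hyx : y = x
    · obtain ⟨z, hz, hzy⟩ := hex v hv y hy
      exact ⟨z, hyx ▸ hzy, hz⟩
    · exact ⟨y, hyx, hy⟩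
  set S := (finite_interiorEdges Γ).toFinset with hS
  set N := (finite_newVertices Γ).toFinset with hN
  have hmemS : ∀ e, e ∈ S ↔ e ∈ interiorEdges Γ := fun e => Set.Finite.mem_toFinset _
  have hmemN : ∀ v, v ∈ N ↔ v ∈ newVertices Γ := fun v => Set.Finite.mem_toFinset _
  obtain ⟨hsub, hdeg⟩ := two_regular_of_card (S := S) (N := N)
    (fun e he => ((hmemS e).1 he).2.1)
    (by rw [hS, hN, ← Set.ncard_eq_toFinset_card _ _, ← Set.ncard_eq_toFinset_card _ _, hb.ncard_eq])
    (by
      intro v hv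
      obtain ⟨x, -, hx⟩ := hne v ((hmemN v).1 hv) v
      obtain ⟨y, hyx, hy⟩ := hne v ((hmemN v).1 hv) x
      have hlt : 1 < (S.filter fun e => v ∈ e).card := Finset.one_lt_card.2 ⟨{v, x},
        Finset.mem_filter.2 ⟨(hmemS _).2 hx, by simp⟩, {v, y},
        Finset.mem_filter.2 ⟨(hmemS _).2 hy, by simp⟩, fun he => hyx (pair_right_injective v he).symm⟩
      exact hlt)
  have hnew : ∀ e ∈ interiorEdges Γ, ∀ v ∈ e, v ∈ newVertices Γ :=
    fun e he v hv => (hmemN v).1 (hsub e ((hmemS e).2 he) hv)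
  refine ⟨hnew, hne, ?_⟩
  intro v x y z hxy hx hy hz
  by_contra! hcon
  have hv := hnew _ hx v (by simp)
  have h2 := hdeg v ((hmemN v).2 hv)
  have h3 : 2 < (S.filter fun e => v ∈ e).card := Finset.two_lt_card.2 ⟨{v, x},
    Finset.mem_filter.2 ⟨(hmemS _).2 hx, by simp⟩, {v, y},
    Finset.mem_filter.2 ⟨(hmemS _).2 hy, by simp⟩, {v, z},
    Finset.mem_filter.2 ⟨(hmemS _).2 hz, by simp⟩,
    fun he => hxy (pair_right_injective v he), fun he => hcon.1 (pair_right_injective v he).symm,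
    fun he => hcon.2 (pair_right_injective v he).symm⟩
  omega

/-! ### Rigid triangulations are triforces -/

/-- In a rigid triangulation, the corner at `A` is cut off by an edge between the adjacent sides. -/
theorem exists_corner {Γ : Triangulation Δ} (hr : IsRigid Γ) (hΔ : Δ ∉ Γ.complex.faces) :
    ∃ q r, {A, q, r} ∈ Γ.complex.faces ∧ l B q = 0 ∧ 0 < l C q ∧ 0 < l A q ∧
      l C r = 0 ∧ 0 < l A r ∧ 0 < l B r := by
  have hm : AffineMap.lineMap B C (1 / 2 : ℝ) ∈ convexHull ℝ (Δ : Set E) := by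
    refine h.coord.lineMap_mem h.rot.hullA h.rot.rot.hullA fun i hi => ?_
    rw [map_lineMap_real]
    linarith [h.coord.nonneg h.rot.hullA hi, h.coord.nonneg h.rot.rot.hullA hi]
  -- Look from `A` towards the midpoint of `B C`: the face containing the start must have vertices
  -- with positive `C`- and `B`-coordinates.
  obtain ⟨σ, hσ, hAσ, δ, hδ, -, hδσ⟩ := Γ.exists_face_germ h.hullA hm
  replace hAσ := vertex_mem_of_mem_hull (h.vertex_mem_faces Γ) hσ hAσ
  obtain ⟨q, hq, hqC⟩ := exists_pos_of_mem_hull hδσ (l C) (by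
    simp only [map_lineMap_real, h.lCA, h.lCB, h.lCC]; linarith)
  obtain ⟨r, hrσ, hrB⟩ := exists_pos_of_mem_hull hδσ (l B) (by
    simp only [map_lineMap_real, h.lBA, h.lBB, h.lBC]; linarith)
  -- Rigidity forbids interior edges at vertices of `Δ`. This pushes `q` and `r` onto the sides
  -- through `A`, and then keeps them from being `C` and `B`, except both at once, when `Δ` would be
  -- a face.
  have hold : ∀ {i y : E}, i ∈ Δ → i ∈ σ → y ∈ σ → {i, y} ∉ interiorEdges Γ :=
    fun hi _ _ he => (hr.subset_new _ he _ (Finset.mem_insert_self _ _)).2 hi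
  have hqT := Γ.mem_of_mem_face hσ hq
  have hrT := Γ.mem_of_mem_face hσ hrσ
  have hAq : A ≠ q := by rintro rfl; linarith [h.lCA]
  have hAr : A ≠ r := by rintro rfl; linarith [h.lBA]
  have hlAA : 0 < l A A := by rw [h.lAA]; norm_num
  have hqB : l B q = 0 := by
    by_contra h0
    exact hold h.memA hAσ hq ((h.mem_interiorEdges_iff hAq).2 ⟨edge_of_mem hσ hAσ hq, Or.inl hlAA,
      Or.inr ((h.rot.nonnegA hqT).lt_of_ne' h0), Or.inr hqC⟩)
  have hrC : l C r = 0 := by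
    by_contra h0
    exact hold h.memA hAσ hrσ ((h.mem_interiorEdges_iff hAr).2 ⟨edge_of_mem hσ hAσ hrσ,
      Or.inl hlAA, Or.inr hrB, Or.inr ((h.rot.rot.nonnegA hrT).lt_of_ne' h0)⟩)
  have hqr : q ≠ r := by rintro rfl; linarith
  have hlBB : 0 < l B B := by rw [h.rot.lAA]; norm_num
  have hlCC : 0 < l C C := by rw [h.lCC]; norm_num
  have hboth : l A q = 0 → l A r = 0 → False := by
    intro hq0 hr0
    have e1 := h.rot.rot.eq_A hqT hq0 hqB
    have e2 := h.rot.eq_A hrT hrC hr0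
    subst e1 e2
    have ht := triangle_of_mem hσ hAσ hrσ hq
    rw [← h.eq] at ht
    exact hΔ ht
  have hqA : l A q ≠ 0 := by
    intro hq0
    have e1 := h.rot.rot.eq_A hqT hq0 hqB
    subst e1
    exact hold h.memC hq hrσ ((h.mem_interiorEdges_iff hqr).2 ⟨edge_of_mem hσ hq hrσ,
      Or.inr ((h.nonnegA hrT).lt_of_ne' (hboth hq0)), Or.inr hrB, Or.inl hlCC⟩)
  have hrA : l A r ≠ 0 := by
    intro hr0
    have e2 := h.rot.eq_A hrT hrC hr0
    subst e2
    exact hold h.memB hrσ hq ((h.mem_interiorEdges_iff hqr.symm).2 ⟨edge_of_mem hσ hrσ hq,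
      Or.inr ((h.nonnegA hqT).lt_of_ne' hqA), Or.inl hlBB, Or.inr hqC⟩)
  exact ⟨q, r, triangle_of_mem hσ hAσ hq hrσ, hqB, hqC, (h.nonnegA hqT).lt_of_ne' hqA, hrC,
    (h.nonnegA hrT).lt_of_ne' hrA, hrB⟩

theorem mem_hull_triple {p q r z : E} (hp : p ∈ convexHull ℝ (Δ : Set E))
    (hq : q ∈ convexHull ℝ (Δ : Set E)) (hr : r ∈ convexHull ℝ (Δ : Set E))
    (hz : z ∈ convexHull ℝ (Δ : Set E)) {a b c : ℝ} (ha : 0 ≤ a) (hb : 0 ≤ b) (hc : 0 ≤ c)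
    (habc : a + b + c = 1) (h1 : l B z = a * l B p + b * l B q + c * l B r)
    (h2 : l C z = a * l C p + b * l C q + c * l C r) :
    z ∈ convexHull ℝ (({p, q, r} : Finset E) : Set E) := by
  have h3 : l A z = a * l A p + b * l A q + c * l A r := by
    linear_combination h.sum hz - a * h.sum hp - b * h.sum hq - c * h.sum hr - h1 - h2 - habc
  have hz' : z = a • p + b • q + c • r := by
    conv_lhs => rw [← h.repr hz, h1, h2, h3]
    conv_rhs => rw [← h.repr hp, ← h.repr hq, ← h.repr hr]
    module
  have := (convex_convexHull ℝ (({p, q, r} : Finset E) : Set E)).sum_mem (t := Finset.univ)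
    (w := ![a, b, c]) (z := ![p, q, r])
    (by intro i _; fin_cases i <;> simpa)
    (by simpa [Fin.sum_univ_three] using habc)
    (by
      intro i _
      refine subset_convexHull ℝ _ ?_
      fin_cases i <;> simp)
  rw [hz']
  simpa [Fin.sum_univ_three] using this

/-- Two triangles on either side of an edge `{q, r}`, both with a side along the side `A C` of `Δ`,
exhaust the neighbourhood of `q`. -/
theorem neighbour_of_fan {Γ : Triangulation Δ} {q r x y : E} (hA : {A, q, r} ∈ Γ.complex.faces)
    (hx : {q, r, x} ∈ Γ.complex.faces) (hqB : l B q = 0) (hxB : l B x = 0) (hqC : 0 < l C q)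
    (hqx : l C q < l C x) (hrB : 0 < l B r) (hy : {q, y} ∈ Γ.complex.faces) (hyB : 0 < l B y) :
    y = r := by
  have hqT := Γ.mem_of_mem_face hA (show q ∈ ({A, q, r} : Finset E) by simp)
  have hrT := Γ.mem_of_mem_face hA (show r ∈ ({A, q, r} : Finset E) by simp)
  have hxT := Γ.mem_of_mem_face hx (show x ∈ ({q, r, x} : Finset E) by simp)
  have hyT := Γ.mem_of_mem_face hy (show y ∈ ({q, y} : Finset E) by simp)
  have hqy : q ≠ y := by rintro rfl; linarith
  -- Expand `y - q = ρ (r - q) + κ (w - q)`, where `w` is `x` or `A`. The `B`-coordinate determines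
  -- `ρ`, since `q` and `w` lie on the side `A C`.
  set ρ := l B y / l B r with hρ
  have hρpos : 0 < ρ := div_pos hyB hrB
  have hρr : ρ * l B r = l B y := by rw [hρ]; field_simp
  have key : ∀ w : E, w ∈ convexHull ℝ (Δ : Set E) → l B w = 0 →
      {q, r, w} ∈ Γ.complex.faces → ∀ κ : ℝ, 0 ≤ κ →
      κ * (l C w - l C q) = (l C y - l C q) - ρ * (l C r - l C q) → y = r := by
    intro w hwT hwB hw κ hκ hκw
    have hK : 0 < 1 + (ρ + κ) := by linarith
    -- This `t` makes `1 - t * ρ - t * κ = t` positive, so the point at `t` on the edge `q y` lies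
    -- in the triangle `q r w`, which must then contain `y`.
    set t := 1 / (1 + (ρ + κ)) with ht
    have ht0 : 0 < t := by positivity
    have ht1 : t * (1 + (ρ + κ)) = 1 := by rw [ht]; field_simp
    have htlt : t < 1 := by nlinarith
    have hzT : AffineMap.lineMap q y t ∈ convexHull ℝ (Δ : Set E) := by
      refine h.coord.lineMap_mem hqT hyT fun i hi => ?_
      rw [map_lineMap_real]
      have h1 := h.coord.nonneg hqT hi
      have h2 := h.coord.nonneg hyT hi
      nlinarith [mul_nonneg ht0.le h2, mul_nonneg (sub_nonneg.2 htlt.le) h1]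
    have hmem : AffineMap.lineMap q y t ∈ convexHull ℝ (({q, r, w} : Finset E) : Set E) := by
      refine h.mem_hull_triple hqT hrT hwT hzT (a := 1 - t * ρ - t * κ) (b := t * ρ) (c := t * κ)
        (by nlinarith) (by positivity) (by positivity) (by ring) ?_ ?_
      · rw [map_lineMap_real, hqB, hwB]
        linear_combination (-t) * hρr
      · rw [map_lineMap_real]
        linear_combination (-t) * hκw
    have := (edge_subset_of_lineMap_mem hy hw ht0 htlt hmem).2
    simp only [Finset.mem_insert, Finset.mem_singleton] at this
    rcases this with h1 | h1 | h1
    · exact absurd h1.symm hqy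
    · exact h1
    · rw [h1] at hyB; linarith
  -- The sign tells on which side of the ray from `q` through `r` the point `y` lies, hence which
  -- triangle of the fan to use.
  rcases le_total 0 ((l C y - l C q) - ρ * (l C r - l C q)) with h0 | h0
  · have hpos : 0 < l C x - l C q := by linarith
    exact key x hxT hxB hx _ (div_nonneg h0 hpos.le) (by field_simp)
  · have hA' : {q, r, A} ∈ Γ.complex.faces :=
      triangle_of_mem hA (by simp) (by simp) (by simp)
    refine key A h.hullA h.lBA hA' (-((l C y - l C q) - ρ * (l C r - l C q)) / l C q)
      (div_nonneg (by linarith) hqC.le) ?_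
    rw [h.lCA]
    field_simp
    ring

/-- The triangle beyond an edge cutting off a corner. -/
theorem corner_mem_faces {Γ : Triangulation Δ} {p q r : E} (hrA : 0 < l A r)
    (hrB : 0 < l B r) (hpB : 0 < l B p) (hpC : 0 < l C p)
    (hrp : {r, p} ∈ interiorEdges Γ) (hr : ∀ y, {r, y} ∈ interiorEdges Γ → y = p ∨ y = q)
    (hp : ∀ y, {p, y} ∈ interiorEdges Γ → y = r ∨ y = q) : {B, r, p} ∈ Γ.complex.faces := by
  -- Of the two triangles at `{r, p}`, at least one has apex different from `q`. By the degree
  -- bounds neither `{r, y}` nor `{p, y}` is interior, which leaves only `y = B`.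
  obtain ⟨y, hy, hyr, hyp, hyq⟩ : ∃ y, {r, p, y} ∈ Γ.complex.faces ∧ y ≠ r ∧ y ≠ p ∧ y ≠ q := by
    obtain ⟨a, b, hab, har, hap, hbr, hbp, ha, hb⟩ := h.exists_two_triangles Γ hrp
    by_cases haq : a = q
    · exact ⟨b, hb, hbr, hbp, fun hbq => hab (haq.trans hbq.symm)⟩
    · exact ⟨a, ha, har, hap, haq⟩
  have hyT := Γ.mem_of_mem_face hy (show y ∈ ({r, p, y} : Finset E) by simp)
  have hyC : l C y = 0 := by
    by_contra h0
    rcases hr y ((h.mem_interiorEdges_iff hyr.symm).2 ⟨edge_of_mem hy (by simp) (by simp),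
      Or.inl hrA, Or.inl hrB, Or.inr ((h.rot.rot.nonnegA hyT).lt_of_ne' h0)⟩) with h1 | h1
    · exact hyp h1
    · exact hyq h1
  have hyA : l A y = 0 := by
    by_contra h0
    rcases hp y ((h.mem_interiorEdges_iff hyp.symm).2 ⟨edge_of_mem hy (by simp) (by simp),
      Or.inr ((h.nonnegA hyT).lt_of_ne' h0), Or.inl hpB, Or.inl hpC⟩) with h1 | h1
    · exact hyr h1
    · exact hyq h1
  have := h.rot.eq_A hyT hyC hyA
  subst this
  exact triangle_of_mem hy (by simp) (by simp) (by simp)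

/-- No interior edge ends at `A`, so the neighbours of `A` lie on its two sides, one on each. -/
theorem star_of_corner {Γ : Triangulation Δ} (hr : IsRigid Γ) {q r : E}
    (hA : {A, q, r} ∈ Γ.complex.faces) (hqB : l B q = 0) (hqC : 0 < l C q) (hrC : l C r = 0)
    (hrB : 0 < l B r) {s : Finset E} (hs : s ∈ Γ.complex.faces) (hAs : A ∈ s) :
    s ⊆ {A, q, r} := by
  intro y hy
  by_cases hyA : y = A
  · simp [hyA]
  have hAy : {A, y} ∈ Γ.complex.faces := edge_of_mem hs hAs hy
  have hyT := Γ.mem_of_mem_face hs hy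
  have hqT := Γ.mem_of_mem_face hA (show q ∈ ({A, q, r} : Finset E) by simp)
  have hrT := Γ.mem_of_mem_face hA (show r ∈ ({A, q, r} : Finset E) by simp)
  have hyB := h.rot.nonnegA hyT
  have hyC := h.rot.rot.nonnegA hyT
  have hAq : A ≠ q := by rintro rfl; linarith [h.lCA]
  have hAr : A ≠ r := by rintro rfl; linarith [h.lBA]
  have hor : l B y = 0 ∨ l C y = 0 := by
    by_contra! hcon
    refine (hr.subset_new _ ((h.mem_interiorEdges_iff (Ne.symm hyA)).2 ⟨hAy, Or.inl ?_,
      Or.inr (hyB.lt_of_ne' hcon.1), Or.inr (hyC.lt_of_ne' hcon.2)⟩) A (by simp)).2 h.memA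
    rw [h.lAA]; norm_num
  rcases hor with h0 | h0
  · have hpos : 0 < l C y := hyC.lt_of_ne' fun h1 => hyA (h.eq_A hyT h0 h1)
    have := eq_of_edges_same_ray (edge_of_mem hA (by simp) (by simp)) hAy hAq
      (s := l C y / l C q) (by positivity) (h.rot.eq_lineMap h.hullA hqT hyT
        (by rw [h0, hqB, h.lBA]; ring) (by rw [h.lCA]; field_simp; ring))
    simp [this]
  · have hpos : 0 < l B y := hyB.lt_of_ne' fun h1 => hyA (h.eq_A hyT h1 h0)
    have := eq_of_edges_same_ray (edge_of_mem hA (by simp) (by simp)) hAy hAr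
      (s := l B y / l B r) (by positivity) (h.rot.eq_lineMap h.hullA hrT hyT
        (by rw [h.lBA]; field_simp; ring) (by rw [h0, hrC, h.lCA]; ring))
    simp [this]

theorem vertex_of_side {Γ : Triangulation Δ} {p y : E} (hBp : {B, p} ∈ Γ.complex.faces)
    (hCp : {C, p} ∈ Γ.complex.faces) (hpA : l A p = 0) (hy : {y} ∈ Γ.complex.faces)
    (hyA : l A y = 0) : y = B ∨ y = p ∨ y = C := by
  have hpT := Γ.mem_of_mem_face hBp (show p ∈ ({B, p} : Finset E) by simp)
  have hyT := Γ.mem_of_mem_face hy (Finset.mem_singleton_self y)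
  have hp := (h.mem_hull_side hpT).2 hpA
  have hys := (h.mem_hull_side hyT).2 hyA
  rw [hull_pair_split (by rwa [Finset.coe_pair, convexHull_pair] at hp)] at hys
  rcases hys with hys | hys
  · have := vertex_mem_of_mem_hull hy (by rwa [Finset.pair_comm]) hys
    simp only [Finset.mem_insert, Finset.mem_singleton] at this
    tauto
  · have := vertex_mem_of_mem_hull hy (by rwa [Finset.pair_comm]) hys
    simp only [Finset.mem_insert, Finset.mem_singleton] at this
    tauto

theorem isTriforce_of_isRigid {Γ : Triangulation Δ} (hb : IsBalanced Γ l) (hr : IsRigid Γ)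
    (hΔ : Δ ∉ Γ.complex.faces) : IsTriforce Γ.complex Δ := by
  obtain ⟨q, r, hT, hqB, hqC, hqA, hrC, hrA, hrB⟩ := h.exists_corner hr hΔ
  have hqT := Γ.mem_of_mem_face hT (show q ∈ ({A, q, r} : Finset E) by simp)
  have hrT := Γ.mem_of_mem_face hT (show r ∈ ({A, q, r} : Finset E) by simp)
  have hqr : q ≠ r := by rintro rfl; linarith
  have hqrI : {q, r} ∈ interiorEdges Γ := (h.mem_interiorEdges_iff hqr).2
    ⟨edge_of_mem hT (by simp) (by simp), Or.inl hqA, Or.inr hrB, Or.inl hqC⟩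
  -- The form is the cross product of `q` and `r`, negative at `A`; it selects the triangle beyond
  -- the edge `{q, r}`.
  obtain ⟨p, hp, hφp⟩ := h.exists_triangle_pos Γ hqrI
    (combo l A B C (-(l C q * l B r)) (l C q * l A r) (l A q * l B r))
    (by rw [combo_apply, hqB]; ring) (by rw [combo_apply, hrC]; ring)
    ⟨A, h.hullA, by rw [h.combo_A, neg_ne_zero]; positivity⟩
  rw [combo_apply] at hφp
  have hpT := Γ.mem_of_mem_face hp (show p ∈ ({q, r, p} : Finset E) by simp)
  have hsq := h.sum hqT
  have hsr := h.sum hrT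
  have hsp := h.sum hpT
  -- If `p` were on the side `C A`, the two triangles at `{q, r}` would fill the neighbourhood of
  -- `q`. Then `r` would be the only interior neighbour of `q`, against rigidity. The side `A B` is
  -- excluded symmetrically with `r`.
  have hpB0 : l B p ≠ 0 := by
    intro h0
    have hlt : l C q < l C p := by
      have e1 : l A q = 1 - l C q := by linarith
      have e2 : l A p = 1 - l C p := by linarith
      rw [h0, e1, e2] at hφp
      have : 0 < l B r * (l C p - l C q) := by linarith
      have := pos_of_mul_pos_right this hrB.le
      linarith
    obtain ⟨y, hyr, hy⟩ := hr.exists_ne q (hr.subset_new _ hqrI q (by simp)) r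
    have hyB : 0 < l B y := by
      rcases ((h.mem_interiorEdges_iff (ne_of_mem_interiorEdges hy)).1 hy).2.2.1 with h1 | h1
      · linarith
      · exact h1
    exact hyr (h.neighbour_of_fan hT hp hqB h0 hqC hlt hrB hy.1 hyB)
  have hpC0 : l C p ≠ 0 := by
    intro h0
    have hlt : l B r < l B p := by
      have e1 : l A r = 1 - l B r := by linarith
      have e2 : l A p = 1 - l B p := by linarith
      rw [h0, e1, e2] at hφp
      have : 0 < l C q * (l B p - l B r) := by linarith
      have := pos_of_mul_pos_right this hqC.le
      linarith
    have hrqI : {r, q} ∈ interiorEdges Γ := by rwa [Finset.pair_comm]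
    obtain ⟨y, hyq, hy⟩ := hr.exists_ne r (hr.subset_new _ hqrI r (by simp)) q
    have hyC : 0 < l C y := by
      rcases ((h.mem_interiorEdges_iff (ne_of_mem_interiorEdges hy)).1 hy).2.2.2 with h1 | h1
      · linarith
      · exact h1
    exact hyq (h.swap.neighbour_of_fan (triangle_of_mem hT (by simp) (by simp) (by simp))
      (triangle_of_mem hp (by simp) (by simp) (by simp)) hrC h0 hrB hlt hqC hy.1 hyC)
  have hpB : 0 < l B p := (h.rot.nonnegA hpT).lt_of_ne' hpB0
  have hpC : 0 < l C p := (h.rot.rot.nonnegA hpT).lt_of_ne' hpC0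
  have hpA : l A p = 0 := by
    obtain ⟨i, hi, hi0⟩ := hb.boundary p (vertex_of_mem hp (by simp))
    rw [h.eq] at hi
    simp only [Finset.mem_insert, Finset.mem_singleton] at hi
    rcases hi with rfl | rfl | rfl
    · exact hi0
    · exact absurd hi0 hpB0
    · exact absurd hi0 hpC0
  have hpq : p ≠ q := by rintro rfl; linarith
  have hrp : r ≠ p := by rintro rfl; linarith
  have hpqI : {p, q} ∈ interiorEdges Γ := (h.mem_interiorEdges_iff hpq).2
    ⟨edge_of_mem hp (by simp) (by simp), Or.inr hqA, Or.inl hpB, Or.inl hpC⟩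
  have hrpI : {r, p} ∈ interiorEdges Γ := (h.mem_interiorEdges_iff hrp).2
    ⟨edge_of_mem hp (by simp) (by simp), Or.inl hrA, Or.inl hrB, Or.inr hpC⟩
  -- The edges of `p q r` already exhaust the interior edges at `p`, `q` and `r`, so the edges `{r,
  -- p}` and `{p, q}` cut off the corners `B` and `C`.
  have hnq : ∀ y, {q, y} ∈ interiorEdges Γ → y = r ∨ y = p := fun y hy =>
    hr.two_neighbours q r p y hrp hqrI (by rwa [Finset.pair_comm]) hy
  have hnr : ∀ y, {r, y} ∈ interiorEdges Γ → y = p ∨ y = q := fun y hy =>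
    hr.two_neighbours r p q y hpq hrpI (by rwa [Finset.pair_comm]) hy
  have hnp : ∀ y, {p, y} ∈ interiorEdges Γ → y = q ∨ y = r := fun y hy =>
    hr.two_neighbours p q r y hqr hpqI (by rwa [Finset.pair_comm]) hy
  have hB : {B, r, p} ∈ Γ.complex.faces := h.corner_mem_faces hrA hrB hpB hpC hrpI hnr
    fun y hy => (hnp y hy).symm
  have hC : {C, p, q} ∈ Γ.complex.faces := h.rot.corner_mem_faces hpB hpC hqC hqA hpqI hnp
    fun y hy => (hnq y hy).symm
  have hM : {p, q, r} ∈ Γ.complex.faces := triangle_of_mem hp (by simp) (by simp) (by simp)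
  have hAq : A ≠ q := by rintro rfl; linarith [h.lCA]
  have hAr : A ≠ r := by rintro rfl; linarith [h.lBA]
  have hBr : B ≠ r := by rintro rfl; linarith [h.lAB]
  have hBp : B ≠ p := by rintro rfl; linarith [h.lCB]
  have hCp : C ≠ p := by rintro rfl; linarith [h.lBC]
  have hCq : C ≠ q := by rintro rfl; linarith [h.lAC]
  refine ⟨A, B, C, p, q, r, h.eq, h.mem_openSegment hpT hpA hpB hpC,
    h.rot.mem_openSegment hqT hqB hqC hqA, h.rot.rot.mem_openSegment hrT hrC hrA hrB, ?_⟩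
  ext s
  simp only [Set.mem_insert_iff, Set.mem_singleton_iff]
  constructor
  · intro hs
    -- A facet at a corner lies in the star of that corner. Any other has all its vertices on the
    -- sides but not in `Δ`, hence among `p, q, r`.
    by_cases hAs : A ∈ s
    · exact Or.inl (hs.2 hT (h.star_of_corner hr hT hqB hqC hrC hrB hs.1 hAs))
    by_cases hBs : B ∈ s
    · exact Or.inr (Or.inl (hs.2 hB (h.rot.star_of_corner hr hB hrC hrA hpA hpC hs.1 hBs)))
    by_cases hCs : C ∈ s
    · exact Or.inr (Or.inr (Or.inl
        (hs.2 hC (h.rot.rot.star_of_corner hr hC hpA hpB hqB hqA hs.1 hCs))))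
    · refine Or.inr (Or.inr (Or.inr (hs.2 hM fun y hy => ?_)))
      have hyv := vertex_of_mem hs.1 hy
      have hyA : y ≠ A := fun e => hAs (e ▸ hy)
      have hyB : y ≠ B := fun e => hBs (e ▸ hy)
      have hyC : y ≠ C := fun e => hCs (e ▸ hy)
      obtain ⟨i, hi, hi0⟩ := hb.boundary y hyv
      rw [h.eq] at hi
      simp only [Finset.mem_insert, Finset.mem_singleton] at hi ⊢
      rcases hi with rfl | rfl | rfl
      · have := h.vertex_of_side (edge_of_mem hB (by simp) (by simp))
          (edge_of_mem hC (by simp) (by simp)) hpA hyv hi0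
        tauto
      · have := h.rot.vertex_of_side (edge_of_mem hC (by simp) (by simp))
          (edge_of_mem hT (by simp) (by simp)) hqB hyv hi0
        tauto
      · have := h.rot.rot.vertex_of_side (edge_of_mem hT (by simp) (by simp))
          (edge_of_mem hB (by simp) (by simp)) hrC hyv hi0
        tauto
  · rintro (rfl | rfl | rfl | rfl)
    · exact h.triangle_mem_facets Γ hT (Finset.card_eq_three.2 ⟨_, _, _, hAq, hAr, hqr, rfl⟩)
    · exact h.triangle_mem_facets Γ hB (Finset.card_eq_three.2 ⟨_, _, _, hBr, hBp, hrp, rfl⟩)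
    · exact h.triangle_mem_facets Γ hC (Finset.card_eq_three.2 ⟨_, _, _, hCp, hCq, hpq, rfl⟩)
    · exact h.triangle_mem_facets Γ hM (Finset.card_eq_three.2 ⟨_, _, _, hpq, hrp.symm, hqr, rfl⟩)

end Labels

/-! ### The internal edge graph -/

/-- The vertices incident to a set of edges. -/
def support {α : Type*} (S : Set (Finset α)) : Set α := {v | ∃ e ∈ S, v ∈ e}

/-- Any two vertices incident to the set of edges are joined by a path of edges. -/
def IsEdgeConnected {α : Type*} (S : Set (Finset α)) : Prop :=
  ∀ x ∈ support S, ∀ y ∈ support S, Relation.ReflTransGen (fun x y => {x, y} ∈ S) x y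

theorem support_insert {α : Type*} (S : Set (Finset α)) (v a : α) :
    support (insert {v, a} S) = insert v (insert a (support S)) := by
  ext x
  simp only [support, Set.mem_ofPred_eq, Set.mem_insert_iff]
  constructor
  · rintro ⟨e, rfl | he, hx⟩
    · simp only [Finset.mem_insert, Finset.mem_singleton] at hx; tauto
    · exact Or.inr (Or.inr ⟨e, he, hx⟩)
  · rintro (rfl | rfl | ⟨e, he, hx⟩)
    · exact ⟨_, Or.inl rfl, by simp⟩
    · exact ⟨_, Or.inl rfl, by simp⟩
    · exact ⟨e, Or.inr he, hx⟩

theorem IsEdgeConnected.insert_edge {α : Type*} {S : Set (Finset α)} (hS : IsEdgeConnected S) (v : α)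
    {a : α} (ha : a ∈ support S) : IsEdgeConnected (insert {v, a} S) := by
  have hmono : ∀ {x y}, Relation.ReflTransGen (fun x y => {x, y} ∈ S) x y →
      Relation.ReflTransGen (fun x y => {x, y} ∈ insert {v, a} S) x y :=
    fun hxy => Relation.ReflTransGen.mono (fun _ _ hab => Or.inr hab) _ _ hxy
  have hva : Relation.ReflTransGen (fun x y => {x, y} ∈ insert {v, a} S) v a :=
    Relation.ReflTransGen.single (Or.inl rfl)
  have hav : Relation.ReflTransGen (fun x y => {x, y} ∈ insert {v, a} S) a v :=
    Relation.ReflTransGen.single (Or.inl (Finset.pair_comm a v))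
  have hx : ∀ x ∈ support (insert {v, a} S),
      Relation.ReflTransGen (fun x y => {x, y} ∈ insert {v, a} S) x a ∧
      Relation.ReflTransGen (fun x y => {x, y} ∈ insert {v, a} S) a x := by
    intro x hx
    rw [support_insert] at hx
    rcases hx with rfl | rfl | hx
    · exact ⟨hva, hav⟩
    · exact ⟨.refl, .refl⟩
    · exact ⟨hmono (hS x hx a ha), hmono (hS a ha x hx)⟩
  exact fun x hx' y hy' => (hx x hx').1.trans (hx y hy').2

theorem isEdgeConnected_singleton {α : Type*} (v a : α) :
    IsEdgeConnected ({{v, a}} : Set (Finset α)) := by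
  rintro x ⟨e, rfl, hx⟩ y ⟨f, rfl, hy⟩
  simp only [Finset.mem_insert, Finset.mem_singleton] at hx hy
  rcases hx with rfl | rfl <;> rcases hy with rfl | rfl
  · exact .refl
  · exact .single rfl
  · exact .single (Finset.pair_comm _ _)
  · exact .refl

section Graph

variable {Δ : Finset E} (Γ : Triangulation Δ)

theorem finite_support : (support (interiorEdges Γ)).Finite := by
  have : support (interiorEdges Γ) = ⋃ e ∈ interiorEdges Γ, (e : Set E) := by
    ext x; simp [support]
  rw [this]
  exact (finite_interiorEdges Γ).biUnion fun e _ => e.finite_toSet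

theorem ncard_edgeSet : (internalEdgeGraph Γ).edgeSet.ncard = (interiorEdges Γ).ncard := by
  let f : Sym2 (InternalVertex Γ) → Finset E := fun s => (s.map Subtype.val).toFinset
  have hmk : ∀ v w, f s(v, w) = {v.1, w.1} := fun v w => Sym2.toFinset_mk_eq
  have hf : Function.Injective f := by
    intro s t hst
    refine Sym2.map.injective Subtype.val_injective (Sym2.ext fun x => ?_)
    rw [← Sym2.mem_toFinset, ← Sym2.mem_toFinset]
    exact Finset.ext_iff.1 hst x
  rw [← Set.ncard_image_of_injective _ hf]
  congr 1
  ext e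
  constructor
  · rintro ⟨s, hs, rfl⟩
    induction s with
    | _ v w =>
      rw [hmk]
      exact hs.2
  · intro he
    obtain ⟨v, w, hne, rfl⟩ := Finset.card_eq_two.1 he.2.1
    refine ⟨s(⟨v, _, he, by simp⟩, ⟨w, _, he, by simp⟩), ⟨?_, he⟩, hmk _ _⟩
    exact fun h => hne (congrArg Subtype.val h)

/-- Finite connected graphs with one more vertex than edges are trees; paths in the edge set are
transferred to the subtype of internal vertices. -/
theorem isTree_of_isEdgeConnected (hne : (interiorEdges Γ).Nonempty)
    (hconn : IsEdgeConnected (interiorEdges Γ))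
    (hcard : (interiorEdges Γ).ncard + 1 = (support (interiorEdges Γ)).ncard) :
    (internalEdgeGraph Γ).IsTree := by
  have : Finite (InternalVertex Γ) := finite_support Γ
  have hreach : ∀ x y, Relation.ReflTransGen (fun x y => {x, y} ∈ interiorEdges Γ) x y →
      ∀ hx : x ∈ support (interiorEdges Γ), ∃ hy : y ∈ support (interiorEdges Γ),
        (internalEdgeGraph Γ).Reachable ⟨x, hx⟩ ⟨y, hy⟩ := by
    intro x y hxy hx
    induction hxy with
    | refl => exact ⟨hx, .refl _⟩
    | tail _ hbc ih =>
      obtain ⟨hb, hr⟩ := ih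
      refine ⟨⟨_, hbc, by simp⟩, hr.trans (SimpleGraph.Adj.reachable ⟨?_, hbc⟩)⟩
      exact fun h => ne_of_mem_interiorEdges hbc (congrArg Subtype.val h)
  obtain ⟨e, he⟩ := hne
  obtain ⟨v, w, -, rfl⟩ := Finset.card_eq_two.1 he.2.1
  have : Nonempty (InternalVertex Γ) := ⟨⟨v, _, he, by simp⟩⟩
  rw [SimpleGraph.isTree_iff_connected_and_card]
  refine ⟨⟨fun x y => ?_⟩, ?_⟩
  · obtain ⟨_, hr⟩ := hreach x.1 y.1 (hconn _ x.2 _ y.2) x.2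
    exact hr
  · rw [Nat.card_coe_set_eq, ncard_edgeSet, hcard]
    exact (Nat.card_coe_set_eq _).symm

theorem hasTriangle_iff : HasTriangle (interiorEdges Γ) ↔ ∃ u v w : InternalVertex Γ,
    (internalEdgeGraph Γ).Adj u v ∧ (internalEdgeGraph Γ).Adj v w ∧
      (internalEdgeGraph Γ).Adj w u := by
  constructor
  · rintro ⟨u, v, w, huv, hvw, hwu, e1, e2, e3⟩
    refine ⟨⟨u, _, e1, by simp⟩, ⟨v, _, e1, by simp⟩, ⟨w, _, e2, by simp⟩, ⟨?_, e1⟩, ⟨?_, e2⟩,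
      ⟨?_, e3⟩⟩
    · exact fun h => huv (congrArg Subtype.val h)
    · exact fun h => hvw (congrArg Subtype.val h)
    · exact fun h => hwu (congrArg Subtype.val h)
  · rintro ⟨u, v, w, ⟨huv, e1⟩, ⟨hvw, e2⟩, ⟨hwu, e3⟩⟩
    exact ⟨u, v, w, fun h => huv (Subtype.ext h), fun h => hvw (Subtype.ext h),
      fun h => hwu (Subtype.ext h), e1, e2, e3⟩

theorem not_hasTriangle_of_isTree (ht : (internalEdgeGraph Γ).IsTree) :
    ¬ HasTriangle (interiorEdges Γ) := by
  rw [hasTriangle_iff]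
  rintro ⟨u, v, w, h1, h2, h3⟩
  exact ht.isAcyclic.cliqueFree le_rfl {u, v, w}
    (SimpleGraph.is3Clique_triple_iff.2 ⟨h1, h3.symm, h2⟩)

end Graph

/-! ### Induction on the number of new vertices -/

/-- A triangulation obtained from the trivial subdivision, with its internal edge graph. -/
structure IsTreelike {Δ : Finset E} (Γ : Triangulation Δ) : Prop where
  fromTrivial : FromTrivial Γ
  graph : interiorEdges Γ = ∅ ∨ (interiorEdges Γ).Nonempty ∧ IsEdgeConnected (interiorEdges Γ) ∧
    (interiorEdges Γ).ncard + 1 = (support (interiorEdges Γ)).ncard ∧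
    ∃! v, v ∈ support (interiorEdges Γ) ∧ v ∈ Δ

/-- A triangulation obtained from a triforce, with its internal edge graph. -/
structure IsTriforcelike {Δ : Finset E} (Γ : Triangulation Δ) : Prop where
  fromTriforce : FromTriforce Γ
  ncard_eq : (support (interiorEdges Γ)).ncard = (interiorEdges Γ).ncard
  notMem : ∀ v ∈ support (interiorEdges Γ), v ∉ Δ

namespace IsFlap

variable {Δ : Finset E} {l : E → E →ᵃ[ℝ] ℝ} {A B C v a u w : E} {Γ Γ₁ : Triangulation Δ}
  (hf : IsFlap Γ l A B v a u w)
  (hΓ₁ : ∀ s, s ∈ Γ₁.complex.faces ↔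
      (s ∈ Γ.complex.faces ∧ v ∉ s) ∨ s = {u, w} ∨ s = {a, u, w})
include hf hΓ₁

theorem notMem_face {s : Finset E} (hs : s ∈ Γ₁.complex.faces) : v ∉ s := by
  have h1 := hf.ne_vu
  have h2 := hf.ne_vw
  have h3 := hf.ne_av.symm
  rcases (hΓ₁ s).1 hs with hs | rfl | rfl
  · exact hs.2
  · simp [h1, h2]
  · simp [h1, h2, h3]

theorem newVertices_eq (hv : v ∉ Δ) : newVertices Γ = insert v (newVertices Γ₁) := by
  have hvert : ∀ x, {x} ∈ Γ₁.complex.faces → {x} ∈ Γ.complex.faces := by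
    intro x hx
    rcases (hΓ₁ _).1 hx with h1 | h1 | h1
    · exact h1.1
    · have hu : u ∈ ({x} : Finset E) := by rw [h1]; simp
      have hw : w ∈ ({x} : Finset E) := by rw [h1]; simp
      rw [Finset.mem_singleton] at hu hw
      exact absurd (hu.trans hw.symm) hf.ne_uw
    · have hu : u ∈ ({x} : Finset E) := by rw [h1]; simp
      have hw : w ∈ ({x} : Finset E) := by rw [h1]; simp
      rw [Finset.mem_singleton] at hu hw
      exact absurd (hu.trans hw.symm) hf.ne_uw
  ext x
  constructor
  · rintro ⟨hx, hxΔ⟩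
    by_cases hxv : x = v
    · exact Or.inl hxv
    · exact Or.inr ⟨(hΓ₁ _).2 (Or.inl ⟨hx, by simpa using Ne.symm hxv⟩), hxΔ⟩
  · rintro (rfl | hx)
    · exact ⟨vertex_of_mem hf.triangle_left (by simp), hv⟩
    · exact ⟨hvert x hx.1, hx.2⟩

variable (h : Labels Δ l A B C)
include h

/-- The merge deletes only the interior edge `{v, a}`, and the edge `{u, w}` it creates lies on a
side. -/
theorem interiorEdges_eq (he : {v, a} ∈ interiorEdges Γ)
    (huniq : ∀ y, {v, y} ∈ interiorEdges Γ → y = a) :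
    interiorEdges Γ = insert {v, a} (interiorEdges Γ₁) := by
  ext e
  constructor
  · intro he'
    by_cases hve : v ∈ e
    · left
      obtain ⟨x, y, hxy, rfl⟩ := Finset.card_eq_two.1 he'.2.1
      simp only [Finset.mem_insert, Finset.mem_singleton] at hve
      rcases hve with rfl | rfl
      · rw [huniq y he']
      · rw [Finset.pair_comm] at he' ⊢
        rw [huniq x he']
    · exact Or.inr ⟨(hΓ₁ e).2 (Or.inl ⟨he'.1, hve⟩), he'.2⟩
  · rintro (rfl | he')
    · exact he
    · rcases (hΓ₁ e).1 he'.1 with h1 | rfl | rfl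
      · exact ⟨h1.1, he'.2⟩
      · have := ((h.mem_interiorEdges_iff hf.ne_uw).1 he').2.1
        rw [hf.left, hf.right] at this
        simp at this
      · have h2 := he'.2.1
        rw [Finset.card_eq_three.2 ⟨a, u, w, hf.ne_au, hf.ne_aw, hf.ne_uw, rfl⟩] at h2
        omega

theorem boundary_of_merge (hb : ∀ x, {x} ∈ Γ.complex.faces → ∃ i ∈ Δ, l i x = 0) :
    ∀ x, {x} ∈ Γ₁.complex.faces → ∃ i ∈ Δ, l i x = 0 := by
  intro x hx
  rcases (hΓ₁ _).1 hx with h1 | h1 | h1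
  · exact hb x h1.1
  · have hu : u ∈ ({x} : Finset E) := by rw [h1]; simp
    rw [Finset.mem_singleton] at hu
    exact ⟨A, h.memA, hu ▸ hf.left⟩
  · have hu : u ∈ ({x} : Finset E) := by rw [h1]; simp
    rw [Finset.mem_singleton] at hu
    exact ⟨A, h.memA, hu ▸ hf.left⟩

/-- The apex of a flap is an internal vertex after merging, unless the merged triangulation is
trivial. -/
theorem apex_mem_support :
    a ∈ support (interiorEdges Γ₁) ∨ interiorEdges Γ₁ = ∅ ∧ a ∈ Δ := by
  have hG : {a, u, w} ∈ Γ₁.complex.faces := (hΓ₁ _).2 (Or.inr (Or.inr rfl))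
  have haT := Γ₁.mem_of_mem_face hG (show a ∈ ({a, u, w} : Finset E) by simp)
  have huT := Γ₁.mem_of_mem_face hG (show u ∈ ({a, u, w} : Finset E) by simp)
  have hwT := Γ₁.mem_of_mem_face hG (show w ∈ ({a, u, w} : Finset E) by simp)
  by_cases ha : a ∈ support (interiorEdges Γ₁)
  · exact Or.inl ha
  right
  -- If neither `{a, u}` nor `{a, w}` is interior, the vanishing coordinates force `a = A`, `u = B`,
  -- `w = C`, so the merged triangle is `Δ`.
  have hau : {a, u} ∉ interiorEdges Γ₁ := fun he => ha ⟨_, he, by simp⟩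
  have haw : {a, w} ∉ interiorEdges Γ₁ := fun he => ha ⟨_, he, by simp⟩
  rw [h.mem_interiorEdges_iff hf.ne_au] at hau
  rw [h.mem_interiorEdges_iff hf.ne_aw] at haw
  have eau := edge_of_mem hG (v := a) (w := u) (by simp) (by simp)
  have eaw := edge_of_mem hG (v := a) (w := w) (by simp) (by simp)
  have hu1 := h.rot.rot.nonnegA huT
  have hw1 := h.rot.nonnegA hwT
  have hsu := h.sum huT
  have hsw := h.sum hwT
  have huB : 0 < l B u := by linarith [hf.left_lt, hf.lt_right]
  have hwC : 0 < l C w := by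
    have := hf.right
    have := hf.left
    linarith [hf.left_lt, hf.lt_right]
  have huC : ¬ (0 < l C a ∨ 0 < l C u) := fun hC =>
    hau ⟨eau, Or.inl hf.apex, Or.inr huB, hC⟩
  have hwB : ¬ (0 < l B a ∨ 0 < l B w) := fun hB =>
    haw ⟨eaw, Or.inl hf.apex, hB, Or.inr hwC⟩
  push Not at huC hwB
  have haB := le_antisymm hwB.1 (h.rot.nonnegA haT)
  have haC := le_antisymm huC.1 (h.rot.rot.nonnegA haT)
  have hwB' := le_antisymm hwB.2 hw1
  have huC' := le_antisymm huC.2 hu1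
  have ea := h.eq_A haT haB haC
  have eu := h.rot.eq_A huT huC' hf.left
  have ew := h.rot.rot.eq_A hwT hf.right hwB'
  rw [ea, eu, ew, ← h.eq] at hG
  refine ⟨h.interiorEdges_eq_empty_of_vertices fun x hx => vertex_mem_of_mem_hull hx hG
    (Γ₁.mem_of_mem_face hx (Finset.mem_singleton_self x)), ?_⟩
  rw [ea]; exact h.memA

/-- `v` becomes a leaf at `a`: one more edge, one more vertex, none of them in `Δ`. If the graph was
empty it becomes the single edge `{v, a}`, whose end `a` is the one vertex in `Δ`. -/
theorem isTreelike (he : {v, a} ∈ interiorEdges Γ)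
    (huniq : ∀ y, {v, y} ∈ interiorEdges Γ → y = a) (hv : v ∉ Δ) (ht : IsTreelike Γ₁) :
    IsTreelike Γ := by
  obtain ⟨Γ₀, h0, hiter⟩ := ht.fromTrivial
  refine ⟨⟨Γ₀, h0, hiter.tail (hf.isConicalFacetRefinement h hΓ₁)⟩, Or.inr ?_⟩
  have hE := hf.interiorEdges_eq hΓ₁ h he huniq
  have hvS : v ∉ support (interiorEdges Γ₁) :=
    fun ⟨e, he, hve⟩ => hf.notMem_face hΓ₁ he.1 hve
  have hnew : ({v, a} : Finset E) ∉ interiorEdges Γ₁ := fun hmem => hvS ⟨_, hmem, by simp⟩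
  have hav := hf.ne_av
  have hempty : interiorEdges Γ₁ = ∅ → a ∈ Δ → (interiorEdges Γ).Nonempty ∧
      IsEdgeConnected (interiorEdges Γ) ∧
      (interiorEdges Γ).ncard + 1 = (support (interiorEdges Γ)).ncard ∧
      ∃! v, v ∈ support (interiorEdges Γ) ∧ v ∈ Δ := by
    intro h1 haΔ
    rw [h1, insert_empty_eq] at hE
    have hsupp : support (interiorEdges Γ) = {v, a} := by
      rw [hE, ← insert_empty_eq, support_insert]
      ext x; simp [support]
    refine ⟨⟨_, he⟩, ?_, ?_, a, ?_, ?_⟩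
    · rw [hE]; exact isEdgeConnected_singleton v a
    · rw [hsupp, hE, Set.ncard_singleton, Set.ncard_pair hav.symm]
    · rw [hsupp]; exact ⟨by simp, haΔ⟩
    · rintro x ⟨hx, hxΔ⟩
      rw [hsupp] at hx
      rcases hx with rfl | hx
      · exact absurd hxΔ hv
      · exact hx
  rcases hf.apex_mem_support hΓ₁ h with ha | ⟨h1, haΔ⟩
  · rcases ht.graph with h1 | ⟨-, hconn, hcard, z, ⟨hz, hzΔ⟩, huz⟩
    · obtain ⟨e, he', -⟩ := ha
      rw [h1] at he'
      exact absurd he' (Set.notMem_empty e)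
    · have hsupp : support (interiorEdges Γ) = insert v (support (interiorEdges Γ₁)) := by
        rw [hE, support_insert, Set.insert_eq_of_mem ha]
      refine ⟨⟨_, he⟩, ?_, ?_, z, ?_, ?_⟩
      · rw [hE]; exact hconn.insert_edge v ha
      · rw [hsupp, hE, Set.ncard_insert_of_notMem hnew (finite_interiorEdges Γ₁),
          Set.ncard_insert_of_notMem hvS (finite_support Γ₁), hcard]
      · rw [hsupp]; exact ⟨Or.inr hz, hzΔ⟩
      · rintro x ⟨hx, hxΔ⟩
        rw [hsupp] at hx
        rcases hx with rfl | hx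
        · exact absurd hxΔ hv
        · exact huz x ⟨hx, hxΔ⟩
  · exact hempty h1 haΔ

/-- The surviving 3-cycle keeps the graph of `Γ₁` nonempty, so `a` is already in it and vertices and
edges both grow by one. -/
theorem isTriforcelike (he : {v, a} ∈ interiorEdges Γ)
    (huniq : ∀ y, {v, y} ∈ interiorEdges Γ → y = a) (hv : v ∉ Δ) (ht : IsTriforcelike Γ₁) :
    IsTriforcelike Γ := by
  obtain ⟨Γ₀, h0, hiter⟩ := ht.fromTriforce
  have hE := hf.interiorEdges_eq hΓ₁ h he huniq
  have hvS : v ∉ support (interiorEdges Γ₁) :=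
    fun ⟨e, he, hve⟩ => hf.notMem_face hΓ₁ he.1 hve
  have hnew : ({v, a} : Finset E) ∉ interiorEdges Γ₁ := fun hmem => hvS ⟨_, hmem, by simp⟩
  have ha : a ∈ support (interiorEdges Γ₁) := by
    rcases hf.apex_mem_support hΓ₁ h with ha | ⟨h1, -⟩
    · exact ha
    · obtain ⟨x, y, -, -, -, -, hxy, -, -⟩ := h.fromTriforce_hasTriangle ht.fromTriforce
      rw [h1] at hxy
      exact absurd hxy (Set.notMem_empty _)
  have hsupp : support (interiorEdges Γ) = insert v (support (interiorEdges Γ₁)) := by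
    rw [hE, support_insert, Set.insert_eq_of_mem ha]
  refine ⟨⟨Γ₀, h0, hiter.tail (hf.isConicalFacetRefinement h hΓ₁)⟩, ?_, ?_⟩
  · rw [hsupp, hE, Set.ncard_insert_of_notMem hnew (finite_interiorEdges Γ₁),
      Set.ncard_insert_of_notMem hvS (finite_support Γ₁), ht.ncard_eq]
  · intro x hx
    rw [hsupp] at hx
    rcases hx with rfl | hx
    · exact hv
    · exact ht.notMem x hx

end IsFlap

namespace Labels

variable {Δ : Finset E} {l : E → E →ᵃ[ℝ] ℝ} {A B C : E} (h : Labels Δ l A B C)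
include h

/-- Triangulations without interior vertices and with the right number of interior edges come from
the trivial subdivision or from a triforce. -/
theorem isTreelike_or_isTriforcelike (n : ℕ) : ∀ Γ : Triangulation Δ, IsBalanced Γ l →
    (newVertices Γ).ncard = n → IsTreelike Γ ∨ IsTriforcelike Γ := by
  induction n with
  | zero =>
    intro Γ _ hn
    rw [Set.ncard_eq_zero (finite_newVertices Γ)] at hn
    have hvert : ∀ v, {v} ∈ Γ.complex.faces → v ∈ Δ := by
      intro v hv
      by_contra hvΔ
      have : v ∈ newVertices Γ := ⟨hv, hvΔ⟩
      rw [hn] at this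
      exact this
    exact Or.inl ⟨⟨Γ, h.isTrivial_of_vertices hvert, .refl⟩,
      Or.inl (h.interiorEdges_eq_empty_of_vertices hvert)⟩
  | succ n ih =>
    intro Γ hb hn
    rcases h.exists_unique_or_isRigid hb with ⟨v, hv, a, he, huniq⟩ | hr
    · obtain ⟨A', B', C', h', hA, hB, hC⟩ := h.exists_labels_side hb hv
      obtain ⟨u, w, hf⟩ := h'.exists_flap Γ hA hB hC he huniq
      obtain ⟨Γ₁, hΓ₁⟩ := hf.exists_merge h'
      have hE := hf.interiorEdges_eq hΓ₁ h' he huniq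
      have hV := hf.newVertices_eq hΓ₁ hv.2
      have hvV : v ∉ newVertices Γ₁ := fun hmem => hf.notMem_face hΓ₁ hmem.1 (by simp)
      have hvE : ({v, a} : Finset E) ∉ interiorEdges Γ₁ :=
        fun hmem => hf.notMem_face hΓ₁ hmem.1 (by simp)
      have hbal := hb.ncard_eq
      rw [hE, Set.ncard_insert_of_notMem hvE (finite_interiorEdges Γ₁), hn] at hbal
      rw [hV, Set.ncard_insert_of_notMem hvV (finite_newVertices Γ₁)] at hn
      rcases ih Γ₁ ⟨hf.boundary_of_merge hΓ₁ h' hb.boundary, by omega⟩ (by omega) with ht | ht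
      · exact Or.inl (hf.isTreelike hΓ₁ h' he huniq hv.2 ht)
      · exact Or.inr (hf.isTriforcelike hΓ₁ h' he huniq hv.2 ht)
    · right
      obtain ⟨x, hx⟩ : (newVertices Γ).Nonempty := by
        rw [← Set.ncard_pos (finite_newVertices Γ)]; omega
      -- A face `Δ` would leave no room for new vertices; this excludes the trivial subdivision,
      -- which is also rigid.
      have hΔ : Δ ∉ Γ.complex.faces := fun hΔ => hx.2 (vertex_mem_of_mem_hull hx.1 hΔ
        (Γ.mem_of_mem_face hx.1 (Finset.mem_singleton_self x)))
      have hsupp : support (interiorEdges Γ) = newVertices Γ := by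
        ext v
        constructor
        · rintro ⟨e, he, hve⟩
          exact hr.subset_new e he v hve
        · intro hv
          obtain ⟨y, -, hy⟩ := hr.exists_ne v hv v
          exact ⟨_, hy, by simp⟩
      refine ⟨⟨Γ, h.isTriforce_of_isRigid hb hr hΔ, .refl⟩, ?_, ?_⟩
      · rw [hsupp, hb.ncard_eq]
      · intro v hv
        rw [hsupp] at hv
        exact hv.2

end Labels

end

end LocalH

/-! ### The main theorem -/

theorem theorem1p1 {E : Type*} [AddCommGroup E] [Module ℝ E] (Δ : Finset E)
    (hΔ : AffineIndependent ℝ ((↑) : Δ → E)) (hcard : Δ.card = 3)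
    (Γ : LocalH.Triangulation Δ) (hΓ : LocalH.localH Γ = 0) :
    (LocalH.FromTrivial Γ ∨ LocalH.FromTriforce Γ) ∧
    (LocalH.FromTrivial Γ ↔
      IsEmpty (LocalH.InternalVertex Γ) ∨ (LocalH.internalEdgeGraph Γ).IsTree) ∧
    (LocalH.FromTriforce Γ ↔ ∃ u v w : LocalH.InternalVertex Γ,
      (LocalH.internalEdgeGraph Γ).Adj u v ∧ (LocalH.internalEdgeGraph Γ).Adj v w ∧
        (LocalH.internalEdgeGraph Γ).Adj w u) ∧
    (LocalH.FromTrivial Γ → Nonempty (LocalH.InternalVertex Γ) →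
      ∃! v : LocalH.InternalVertex Γ, v.1 ∈ Δ) ∧
    (LocalH.FromTriforce Γ →
      Nat.card (LocalH.InternalVertex Γ) = (LocalH.internalEdgeGraph Γ).edgeSet.ncard ∧
        ∀ v : LocalH.InternalVertex Γ, v.1 ∉ Δ) := by
  obtain ⟨l, A, B, C, h⟩ := LocalH.exists_labels hΔ hcard
  rw [← LocalH.hasTriangle_iff]
  -- It remains to see that the two cases exclude each other: a 3-cycle rules out the empty graph
  -- and trees, and a graph with edges but without vertices of `Δ` rules out the trivial origin.
  rcases h.isTreelike_or_isTriforcelike _ Γ (h.isBalanced hΓ) rfl with ht | ht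
  · have htree : IsEmpty (LocalH.InternalVertex Γ) ∨ (LocalH.internalEdgeGraph Γ).IsTree := by
      rcases ht.graph with h1 | ⟨hne, hconn, hc, -⟩
      · left
        refine ⟨fun ⟨v, e, he, _⟩ => ?_⟩
        rw [h1] at he
        exact he
      · exact Or.inr (LocalH.isTree_of_isEdgeConnected Γ hne hconn hc)
    have hno : ¬ LocalH.HasTriangle (LocalH.interiorEdges Γ) := by
      rcases htree with h1 | h1
      · rintro ⟨u, v, w, -, -, -, he, -⟩
        exact h1.false ⟨u, _, he, by simp⟩
      · exact LocalH.not_hasTriangle_of_isTree Γ h1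
    have hno' : ¬ LocalH.FromTriforce Γ := fun hf => hno (h.fromTriforce_hasTriangle hf)
    refine ⟨Or.inl ht.fromTrivial, ⟨fun _ => htree, fun _ => ht.fromTrivial⟩,
      ⟨fun hf => absurd hf hno', fun hf => absurd hf hno⟩, fun _ hne => ?_,
      fun hf => absurd hf hno'⟩
    rcases ht.graph with h1 | ⟨-, -, -, z, ⟨hz, hzΔ⟩, huz⟩
    · obtain ⟨v, e, he, -⟩ := hne
      rw [h1] at he
      exact absurd he (Set.notMem_empty e)
    · exact ⟨⟨z, hz⟩, hzΔ, fun y hy => Subtype.ext (huz y.1 ⟨y.2, hy⟩)⟩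
  · have htri := h.fromTriforce_hasTriangle ht.fromTriforce
    have hno : ¬ LocalH.FromTrivial Γ := by
      intro hf
      rcases h.fromTrivial_vertices_or_mem hf with h1 | ⟨e, he, a, ha, haΔ⟩
      · obtain ⟨u, v, w, -, -, -, he, -⟩ := htri
        rw [h.interiorEdges_eq_empty_of_vertices h1] at he
        exact he
      · exact ht.notMem a ⟨e, he, ha⟩ haΔ
    refine ⟨Or.inr ht.fromTriforce, ⟨fun hf => absurd hf hno, ?_⟩,
      ⟨fun _ => htri, fun _ => ht.fromTriforce⟩, fun hf => absurd hf hno, fun _ => ⟨?_, ?_⟩⟩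
    · rintro (h1 | h1)
      · obtain ⟨u, v, w, -, -, -, he, -⟩ := htri
        exact (h1.false ⟨u, _, he, by simp⟩).elim
      · exact absurd htri (LocalH.not_hasTriangle_of_isTree Γ h1)
    · rw [LocalH.ncard_edgeSet, ← ht.ncard_eq]
      exact Nat.card_coe_set_eq _
    · exact fun v => ht.notMem v.1 v.2
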